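/- Let $d\ge 2$, let $\mathbb S^{d-1}\subset\mathbb R^d$ be the Euclidean unit sphere and $S$ the uniform probability measure on it. Let $H_k^d\subset L^2(S)$ be the space of restrictions to $\mathbb S^{d-1}$ of real homogeneous harmonic polynomials of degree $k$, let $N_k^d=\dim H_k^d$, and for $f\in C(\mathbb S^{d-1})$ let $f_k$ be the orthogonal projection of $f$ onto $H_k^d$ in $L^2(S)$; $\|f_k\|_1$ and $\|f_k\|_2$ are the norms in $L^1(S)$ and $L^2(S)$. For a finite signed Borel measure $\pi$ on $\mathbb S^{d-1}$ put $h_\pi(x)=\int_{\mathbb S^{d-1}}|w^Tx|\,d\pi(w)$, and let $$\gamma_1(h)=\inf\{\|\pi\|_1 : \pi \text{ an even finite signed Borel measure on } \mathbb S^{d-1},\ h=h_\pi\},$$ where $\|\pi\|_1$ is the total variation ($\gamma_1(h)=\infty$ if there is no such $\pi$). **Proposition.** For every $d\ge 2$ let $f^{(d)}:\mathbb S^{d-1}\to\mathbb R$ be an even continuous function. Assume that there are constants $M,N>0$ and $C$ such that for all $d\ge 2$ $$\sqrt{N_k^d}\,\|f_k^{(d)}\|_1\le C\,\max(k,1)^M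 d^N\,\|f_k^{(d)}\|_2\quad\text{for all }k\ge 0,\qquad \sum_{k=0}^\infty \max(k,1)^{M+2}\|f_k^{(d)}\|_2\le C\,d^N .$$ Then there are constants $A,B$ such that $\gamma_1(f^{(d)})\le A\,d^B$ for all $d\ge2$. Moreover, $\{f^{(d)}\}_{d\ge2}$ is universally approximable by homogeneous one-hidden-layer absolute-value networks: there are constants $\alpha,\beta>0$ such that for all $d\ge 2$ and $\epsilon\in(0,1)$ there are $n\in\mathbb N$, $u\in\mathbb R^n$ and $w_1,\dots,w_n\in\mathbb S^{d-1}$ such that $$\sup_{x\in\mathbb S^{d-1}}\Bigl|f^{(d)}(x)-\sum_{j=1}^n u_j\,|w_j^Tx|\Bigr|\le\epsilon\qquad\text{and}\qquad n+\max\Bigl(\max_j|u_j|,\ \max_j\|w_j\|_\infty\Bigr)\le\alpha\,(d\,\epsilon^{-1})^\beta ,$$ where the maxima are $0$ if $n=0$. -/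

import Mathlib

open MeasureTheory
open scoped ENNReal RealInnerProductSpace

noncomputable section

/-- The unit sphere `𝕊^{d-1}` of `ℝ^d`, with the Euclidean norm. -/
abbrev USphere (d : ℕ) : Type :=
  Metric.sphere (0 : EuclideanSpace ℝ (Fin d)) 1

/-- The uniform probability measure on `𝕊^{d-1}`: the normalized surface measure. -/
def uniformSphere (d : ℕ) : Measure (USphere d) :=
  ((volume : Measure (EuclideanSpace ℝ (Fin d))).toSphere Set.univ)⁻¹ •
    (volume : Measure (EuclideanSpace ℝ (Fin d))).toSphere

instance instIsZeroOrProbabilityMeasureUniformSphere (d : ℕ) :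
    IsZeroOrProbabilityMeasure (uniformSphere d) := by
  unfold uniformSphere; infer_instance

/-! ### Spherical harmonics -/

/-- The Laplacian `∑ᵢ ∂²/∂xᵢ²` on polynomials in `d` variables. -/
def polyLaplacian (d : ℕ) : MvPolynomial (Fin d) ℝ →ₗ[ℝ] MvPolynomial (Fin d) ℝ :=
  ∑ i : Fin d, (MvPolynomial.pderiv i).toLinearMap ∘ₗ (MvPolynomial.pderiv i).toLinearMap

/-- Homogeneous harmonic polynomials of degree `k` in `d` variables. -/
def harmonicPoly (d k : ℕ) : Submodule ℝ (MvPolynomial (Fin d) ℝ) :=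
  MvPolynomial.homogeneousSubmodule (Fin d) ℝ k ⊓ LinearMap.ker (polyLaplacian d)

/-- Restriction of a polynomial to the sphere. -/
def restrictToSphere (d : ℕ) : MvPolynomial (Fin d) ℝ →ₗ[ℝ] C(USphere d, ℝ) where
  toFun p := ⟨fun x => MvPolynomial.eval (fun i => x.1 i) p, by
    refine (MvPolynomial.continuous_eval p).comp ?_
    fun_prop⟩
  map_add' p q := by ext x; simp
  map_smul' c p := by ext x; simp

/-- The space `H_k^d ⊆ L²(S)` of spherical harmonics of degree `k`: restrictions to the sphere of
homogeneous harmonic polynomials of degree `k`. -/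
def sphHarmonics (d k : ℕ) : Submodule ℝ (Lp ℝ 2 (uniformSphere d)) :=
  (harmonicPoly d k).map
    ((ContinuousMap.toLp 2 (uniformSphere d) ℝ).toLinearMap ∘ₗ restrictToSphere d)

instance instFiniteDimensionalHarmonicPoly (d k : ℕ) :
    FiniteDimensional ℝ (harmonicPoly d k) := by
  have : FiniteDimensional ℝ (MvPolynomial.homogeneousSubmodule (Fin d) ℝ k) :=
    Module.Finite.iff_fg.mpr (MvPolynomial.homogeneousSubmodule_fg (σ := Fin d) (R := ℝ) k)
  exact Submodule.finiteDimensional_of_le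
    (inf_le_left : harmonicPoly d k ≤ MvPolynomial.homogeneousSubmodule (Fin d) ℝ k)

instance instFiniteDimensionalSphHarmonics (d k : ℕ) :
    FiniteDimensional ℝ (sphHarmonics d k) := by
  unfold sphHarmonics; infer_instance

/-- `N_k^d`, the dimension of `H_k^d`. -/
def sphDim (d k : ℕ) : ℕ := Module.finrank ℝ (sphHarmonics d k)

/-- The degree `k` spherical harmonic component `f_k` of a continuous function `f` on the sphere:
its orthogonal projection in `L²(S)` onto `H_k^d`. -/
def sphComponent {d : ℕ} (k : ℕ) (f : C(USphere d, ℝ)) : Lp ℝ 2 (uniformSphere d) :=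
  (sphHarmonics d k).starProjection (ContinuousMap.toLp 2 (uniformSphere d) ℝ f)

/-- `‖f_k‖₁`, the `L¹(S)` norm of the degree `k` component of `f`. -/
def componentL1 {d : ℕ} (k : ℕ) (f : C(USphere d, ℝ)) : ℝ :=
  ∫ x, |sphComponent k f x| ∂(uniformSphere d)

/-- `‖f_k‖₂`, the `L²(S)` norm of the degree `k` component of `f`. -/
def componentL2 {d : ℕ} (k : ℕ) (f : C(USphere d, ℝ)) : ℝ :=
  ‖sphComponent k f‖

/-! ### The variation norm `γ₁` -/

/-- A signed measure on the sphere is even if it is invariant under `w ↦ -w`. -/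
def IsEvenMeasure {d : ℕ} (π : SignedMeasure (USphere d)) : Prop :=
  π.map (fun w => -w) = π

/-- `h_π(x) = ∫ |⟨w, x⟩| dπ(w)`. -/
def absPotential {d : ℕ} (π : SignedMeasure (USphere d)) (x : USphere d) : ℝ :=
  ∫ᵛ w, |⟪(w : EuclideanSpace ℝ (Fin d)), (x : EuclideanSpace ℝ (Fin d))⟫| ∂•π

/-- `γ₁(h)`: the infimum of the total variations of the even signed measures `π` with `h = h_π`.
It equals `∞` exactly when `h` is not of the form `h_π`, that is when `h ∉ ℋ¹`. -/
def gammaOne {d : ℕ} (h : USphere d → ℝ) : ℝ≥0∞ :=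
  ⨅ (π : SignedMeasure (USphere d)) (_ : IsEvenMeasure π) (_ : h = absPotential π),
    π.totalVariation Set.univ

/-! ### Homogeneous one-hidden-layer networks with absolute value activation -/

/-- The network `x ↦ ∑ₖ uₖ |⟨wₖ, x⟩|` of width `n`. -/
def absNetwork {d n : ℕ} (u : Fin n → ℝ) (w : Fin n → USphere d) (x : USphere d) : ℝ :=
  ∑ k, u k * |⟪(w k : EuclideanSpace ℝ (Fin d)), (x : EuclideanSpace ℝ (Fin d))⟫|

/-- `m_∞`: the largest absolute value of an entry of a weight (of the hidden or of the output
layer) of the network. The norms here are sup norms, and the value is `0` for `n = 0`. -/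
def weightNorm {d n : ℕ} (u : Fin n → ℝ) (w : Fin n → USphere d) : ℝ :=
  max ‖u‖ ‖fun (k : Fin n) (i : Fin d) => (w k : EuclideanSpace ℝ (Fin d)) i‖

/-- The functions `f^{(d)}`, `d ≥ 2`, are approximable in the uniform norm by homogeneous absolute
value networks whose size and weights are polynomial in `d` and `ε⁻¹`. -/
def UniversallyApproximableAbs (f : (d : ℕ) → USphere d → ℝ) : Prop :=
  ∃ α > (0 : ℝ), ∃ β > (0 : ℝ), ∀ d : ℕ, 2 ≤ d → ∀ ε : ℝ, 0 < ε → ε < 1 →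
    ∃ (n : ℕ) (u : Fin n → ℝ) (w : Fin n → USphere d),
      (∀ x, |f d x - absNetwork u w x| ≤ ε) ∧
      (n : ℝ) + weightNorm u w ≤ α * ((d : ℝ) * ε⁻¹) ^ β

end

noncomputable section

set_option linter.unusedSectionVars false

/-! ### Gaussian integrals of functions of polynomial growth -/

section GaussGrowth

variable {E V : Type*} [NormedAddCommGroup E] [InnerProductSpace ℝ E]
  [NormedAddCommGroup V] [NormedSpace ℝ V]

/-- The unnormalized standard Gaussian density. -/
def gaussDensity (w : E) : ℝ := Real.exp (-‖w‖ ^ 2 / 2)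

/-- Continuous functions of at most polynomial growth. -/
def PolyGrowth (F : E → V) : Prop :=
  Continuous F ∧ ∃ (C : ℝ) (k : ℕ), ∀ w, ‖F w‖ ≤ C * (1 + ‖w‖) ^ k

lemma gaussDensity_pos (w : E) : 0 < gaussDensity w := Real.exp_pos _

lemma continuous_gaussDensity : Continuous (gaussDensity : E → ℝ) := by
  unfold gaussDensity; fun_prop

lemma PolyGrowth.of_bounded {F : E → V} (hF : Continuous F) {C : ℝ} (h : ∀ w, ‖F w‖ ≤ C) :
    PolyGrowth F := ⟨hF, C, 0, by simpa using h⟩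

lemma polyGrowth_inner (v : E) : PolyGrowth (fun w : E => ⟪v, w⟫) := by
  refine ⟨by fun_prop, ‖v‖, 1, fun w => ?_⟩
  refine (norm_inner_le_norm v w).trans ?_
  rw [pow_one]
  gcongr
  linarith

lemma PolyGrowth.add {F F' : E → V} (hF : PolyGrowth F) (hF' : PolyGrowth F') :
    PolyGrowth (fun w => F w + F' w) := by
  obtain ⟨h, C, k, hC⟩ := hF
  obtain ⟨h', C', k', hC'⟩ := hF'
  refine ⟨h.add h', |C| + |C'|, max k k', fun w => (norm_add_le _ _).trans ?_⟩
  have h1 : (1 : ℝ) ≤ 1 + ‖w‖ := by linarith [norm_nonneg w]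
  rw [add_mul]
  gcongr
  · refine (hC w).trans ?_
    gcongr
    · exact le_abs_self C
    · exact le_max_left _ _
  · refine (hC' w).trans ?_
    gcongr
    · exact le_abs_self C'
    · exact le_max_right _ _

lemma PolyGrowth.smul {𝕜 : Type*} [NormedField 𝕜] [NormedSpace 𝕜 V] {c : E → 𝕜} {F : E → V}
    [NormedSpace ℝ 𝕜] (hc : PolyGrowth c) (hF : PolyGrowth F) :
    PolyGrowth (fun w => c w • F w) := by
  obtain ⟨h, C, k, hC⟩ := hc
  obtain ⟨h', C', k', hC'⟩ := hF
  refine ⟨h.smul h', C * C', k + k', fun w => ?_⟩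
  rw [norm_smul, pow_add, mul_mul_mul_comm]
  gcongr
  · exact (norm_nonneg _).trans (hC w)
  · exact hC w
  · exact hC' w

lemma one_add_pow_mul_exp_le (k : ℕ) {x : ℝ} (hx : 0 ≤ x) :
    (1 + x) ^ k * Real.exp (-x ^ 2 / 2) ≤ (k.factorial * Real.exp 2) * Real.exp (-(1 / 4) * x ^ 2) := by
  have h1 : (1 + x) ^ k ≤ k.factorial * Real.exp (1 + x) := by
    have := Real.pow_div_factorial_le_exp (1 + x) (by linarith) k
    rwa [div_le_iff₀' (by positivity)] at this
  calc (1 + x) ^ k * Real.exp (-x ^ 2 / 2)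
      ≤ k.factorial * Real.exp (1 + x) * Real.exp (-x ^ 2 / 2) := by gcongr
    _ = k.factorial * Real.exp (1 + x + -x ^ 2 / 2) := by rw [mul_assoc, ← Real.exp_add]
    _ ≤ k.factorial * Real.exp (2 + -(1 / 4) * x ^ 2) := by
        refine mul_le_mul_of_nonneg_left (Real.exp_le_exp.2 ?_) (by positivity)
        nlinarith [sq_nonneg (x - 2)]
    _ = _ := by rw [Real.exp_add, mul_assoc]

variable [FiniteDimensional ℝ E] [MeasurableSpace E] [BorelSpace E]

lemma integrable_exp_neg_mul_sq_norm {b : ℝ} (hb : 0 < b) :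
    Integrable (fun w : E => Real.exp (-b * ‖w‖ ^ 2)) := by
  have h := (GaussianFourier.integrable_cexp_neg_mul_sq_norm_add (V := E) (b := (b : ℂ))
    (by simpa using hb) 0 0).norm
  refine h.congr (.of_forall fun w => ?_)
  simp only [inner_zero_left, Complex.ofReal_zero, mul_zero, add_zero, Complex.norm_exp]
  congr 1
  have : (-(b : ℂ) * (‖w‖ : ℂ) ^ 2) = ((-b * ‖w‖ ^ 2 : ℝ) : ℂ) := by push_cast; ring
  rw [this, Complex.ofReal_re]

lemma PolyGrowth.integrable_gauss {F : E → V} (hF : PolyGrowth F) :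
    Integrable (fun w => gaussDensity w • F w) := by
  obtain ⟨h, C, k, hC⟩ := hF
  refine ((integrable_exp_neg_mul_sq_norm (E := E) (b := 1 / 4) (by norm_num)).const_mul
    (C * (k.factorial * Real.exp 2))).mono'
    (continuous_gaussDensity.smul h).aestronglyMeasurable (.of_forall fun w => ?_)
  have hC0 : 0 ≤ C := by
    have h0 := (norm_nonneg _).trans (hC 0)
    simpa using h0
  rw [norm_smul, Real.norm_of_nonneg (gaussDensity_pos w).le]
  calc gaussDensity w * ‖F w‖ ≤ gaussDensity w * (C * (1 + ‖w‖) ^ k) := by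
        gcongr
        · exact (gaussDensity_pos w).le
        · exact hC w
    _ = C * ((1 + ‖w‖) ^ k * Real.exp (-‖w‖ ^ 2 / 2)) := by unfold gaussDensity; ring
    _ ≤ C * ((k.factorial * Real.exp 2) * Real.exp (-(1 / 4) * ‖w‖ ^ 2)) :=
        mul_le_mul_of_nonneg_left (one_add_pow_mul_exp_le k (norm_nonneg w)) hC0
    _ = _ := by ring

lemma hasLineDerivAt_gaussDensity (w v : E) :
    HasLineDerivAt ℝ gaussDensity (-(⟪v, w⟫ * gaussDensity w)) w v := by
  have h1 : HasFDerivAt (fun w : E => -‖w‖ ^ 2 / 2) (-(innerSL ℝ w)) w := by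
    have := ((hasStrictFDerivAt_norm_sq w).hasFDerivAt.neg).mul_const (1 / 2 : ℝ)
    refine (this.congr_fderiv ?_).congr_of_eventuallyEq (.of_forall fun w => ?_)
    · ext v; simp
    · simp; ring
  have h2 : HasLineDerivAt ℝ gaussDensity (gaussDensity w * -⟪w, v⟫) w v :=
    (h1.exp).hasLineDerivAt v
  rwa [mul_neg, mul_comm, real_inner_comm] at h2

/-- Gaussian integration by parts. -/
lemma gauss_integral_inner_smul {F F' : E → V} (v : E) (hF : PolyGrowth F) (hF' : PolyGrowth F')
    (h : ∀ w, HasLineDerivAt ℝ F (F' w) w v) :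
    ∫ w, gaussDensity w • (⟪v, w⟫ • F w) = ∫ w, gaussDensity w • F' w := by
  have key := integral_bilinear_hasLineDerivAt_right_eq_neg_left_of_integrable (μ := volume)
    (f := (gaussDensity : E → ℝ)) (f' := fun w => -(⟪v, w⟫ * gaussDensity w))
    (g := F) (g' := F') (v := v) (B := ContinuousLinearMap.lsmul ℝ ℝ)
    ?_ ?_ ?_ (fun w _ => hasLineDerivAt_gaussDensity w v) (fun w _ => h w)
  · change ∫ w, gaussDensity w • F' w = -∫ w, -(⟪v, w⟫ * gaussDensity w) • F w at key
    rw [key, ← integral_neg]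
    refine integral_congr_ae (.of_forall fun w => ?_)
    simp [smul_smul, mul_comm]
  · refine (((polyGrowth_inner v).smul hF).integrable_gauss).neg.congr (.of_forall fun w => ?_)
    simp [smul_smul, mul_comm]
  · exact hF'.integrable_gauss
  · exact hF.integrable_gauss

end GaussGrowth

/-! ### Polynomials as functions on Euclidean space -/

section PolyFun

variable {d : ℕ}

/-- The function on `ℝ^d` given by a polynomial. -/
def polyFun (p : MvPolynomial (Fin d) ℝ) (w : EuclideanSpace ℝ (Fin d)) : ℝ :=
  MvPolynomial.eval (fun i => w i) p

@[simp] lemma polyFun_add (p q : MvPolynomial (Fin d) ℝ) (w) :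
    polyFun (p + q) w = polyFun p w + polyFun q w := by simp [polyFun]

@[simp] lemma polyFun_mul (p q : MvPolynomial (Fin d) ℝ) (w) :
    polyFun (p * q) w = polyFun p w * polyFun q w := by simp [polyFun]

@[simp] lemma polyFun_C (c : ℝ) (w : EuclideanSpace ℝ (Fin d)) :
    polyFun (MvPolynomial.C c) w = c := by simp [polyFun]

@[simp] lemma polyFun_zero (w : EuclideanSpace ℝ (Fin d)) : polyFun 0 w = 0 := by simp [polyFun]

@[simp] lemma polyFun_smul (c : ℝ) (p : MvPolynomial (Fin d) ℝ) (w) :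
    polyFun (c • p) w = c * polyFun p w := by simp [polyFun]

@[simp] lemma polyFun_X (i : Fin d) (w) : polyFun (MvPolynomial.X i) w = w i := by
  simp [polyFun]

lemma polyFun_sum {ι : Type*} (s : Finset ι) (p : ι → MvPolynomial (Fin d) ℝ) (w) :
    polyFun (∑ i ∈ s, p i) w = ∑ i ∈ s, polyFun (p i) w := by simp [polyFun]

lemma continuous_polyFun (p : MvPolynomial (Fin d) ℝ) : Continuous (polyFun p) :=
  (MvPolynomial.continuous_eval p).comp (by fun_prop)

lemma polyGrowth_polyFun (p : MvPolynomial (Fin d) ℝ) : PolyGrowth (polyFun p) := by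
  induction p using MvPolynomial.induction_on with
  | C c => exact PolyGrowth.of_bounded (continuous_polyFun _) (C := ‖c‖) (by simp)
  | add p q hp hq => simpa only [← polyFun_add] using hp.add hq
  | mul_X p i hp =>
    have h : PolyGrowth (fun w : EuclideanSpace ℝ (Fin d) => w i) := by
      have := polyGrowth_inner (EuclideanSpace.single i (1 : ℝ))
      simp only [EuclideanSpace.inner_single_left, map_one, one_mul] at this
      exact this
    have := hp.smul h
    simp only [smul_eq_mul, ← polyFun_X, ← polyFun_mul] at this
    exact this

/-- The derivative of a polynomial in the direction `x`. -/
def polyDeriv (x : EuclideanSpace ℝ (Fin d)) :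
    MvPolynomial (Fin d) ℝ →ₗ[ℝ] MvPolynomial (Fin d) ℝ :=
  ∑ i, x i • (MvPolynomial.pderiv i).toLinearMap

lemma polyDeriv_apply (x : EuclideanSpace ℝ (Fin d)) (p) :
    polyDeriv x p = ∑ i, x i • MvPolynomial.pderiv i p := by
  simp [polyDeriv]

lemma polyDeriv_mul (x : EuclideanSpace ℝ (Fin d)) (p q : MvPolynomial (Fin d) ℝ) :
    polyDeriv x (p * q) = polyDeriv x p * q + p * polyDeriv x q := by
  simp only [polyDeriv_apply, MvPolynomial.pderiv_mul, smul_add, Finset.sum_add_distrib,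
    Finset.sum_mul, Finset.mul_sum, smul_mul_assoc, mul_smul_comm]

@[simp] lemma polyDeriv_single (i : Fin d) (p : MvPolynomial (Fin d) ℝ) :
    polyDeriv (EuclideanSpace.single i 1) p = MvPolynomial.pderiv i p := by
  classical
  simp [polyDeriv_apply, ite_smul]

lemma hasLineDerivAt_polyFun (p : MvPolynomial (Fin d) ℝ) (w x) :
    HasLineDerivAt ℝ (polyFun p) (polyFun (polyDeriv x p) w) w x := by
  unfold HasLineDerivAt
  induction p using MvPolynomial.induction_on with
  | C c =>
    simp only [polyFun_C, polyDeriv_apply, MvPolynomial.pderiv_C, smul_zero, Finset.sum_const_zero,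
      polyFun_zero]
    exact hasDerivAt_const _ _
  | add p q hp hq =>
    simp only [polyFun_add, map_add]
    exact hp.add hq
  | mul_X p i hp =>
    have hX : polyFun (polyDeriv x (MvPolynomial.X i)) w = x i := by
      classical
      have h1 : polyFun 1 w = 1 := by simp [polyFun]
      simp [polyDeriv_apply, MvPolynomial.pderiv_X, Pi.single_apply, h1]
    have h : HasDerivAt (fun t : ℝ => polyFun (MvPolynomial.X i) (w + t • x)) (x i) 0 := by
      simp only [polyFun_X, PiLp.add_apply, PiLp.smul_apply, smul_eq_mul]
      simpa using ((hasDerivAt_id (0 : ℝ)).mul_const (x i)).const_add (w i)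
    have := hp.mul h
    simp only [polyFun_mul, polyDeriv_mul, polyFun_add, hX]
    simp only [zero_smul, add_zero] at this
    exact this

lemma pderiv_comm (i j : Fin d) (p : MvPolynomial (Fin d) ℝ) :
    MvPolynomial.pderiv i (MvPolynomial.pderiv j p) =
      MvPolynomial.pderiv j (MvPolynomial.pderiv i p) := by
  classical
  induction p using MvPolynomial.induction_on with
  | C c => simp
  | add p q hp hq => simp [hp, hq]
  | mul_X p k hp =>
    have (a b : Fin d) : MvPolynomial.pderiv a ((Pi.single b 1 : Fin d → MvPolynomial (Fin d) ℝ) k) = 0 := by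
      rw [Pi.single_apply]; split <;> simp
    simp [MvPolynomial.pderiv_X, hp, this]
    ring

lemma polyLaplacian_apply (p : MvPolynomial (Fin d) ℝ) :
    polyLaplacian d p = ∑ i, MvPolynomial.pderiv i (MvPolynomial.pderiv i p) := by
  simp [polyLaplacian]

lemma polyLaplacian_pderiv (j : Fin d) (p : MvPolynomial (Fin d) ℝ) :
    polyLaplacian d (MvPolynomial.pderiv j p) = MvPolynomial.pderiv j (polyLaplacian d p) := by
  simp only [polyLaplacian_apply, map_sum]
  refine Finset.sum_congr rfl fun i _ => ?_
  rw [pderiv_comm i j p, pderiv_comm i j]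

lemma mem_harmonicPoly {k : ℕ} {p : MvPolynomial (Fin d) ℝ} :
    p ∈ harmonicPoly d k ↔ p.IsHomogeneous k ∧ polyLaplacian d p = 0 := by
  simp [harmonicPoly, MvPolynomial.mem_homogeneousSubmodule]

lemma pderiv_mem_harmonicPoly {k : ℕ} {p : MvPolynomial (Fin d) ℝ} (i : Fin d)
    (hp : p ∈ harmonicPoly d k) : MvPolynomial.pderiv i p ∈ harmonicPoly d (k - 1) := by
  rw [mem_harmonicPoly] at hp ⊢
  exact ⟨hp.1.pderiv, by rw [polyLaplacian_pderiv, hp.2, map_zero]⟩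

lemma polyDeriv_mem_harmonicPoly {k : ℕ} {p : MvPolynomial (Fin d) ℝ} (x : EuclideanSpace ℝ (Fin d))
    (hp : p ∈ harmonicPoly d k) : polyDeriv x p ∈ harmonicPoly d (k - 1) := by
  rw [polyDeriv_apply]
  exact Submodule.sum_mem _ fun i _ => Submodule.smul_mem _ _ (pderiv_mem_harmonicPoly i hp)

lemma polyFun_smul_arg {k : ℕ} {p : MvPolynomial (Fin d) ℝ} (hp : p.IsHomogeneous k) (r : ℝ)
    (w : EuclideanSpace ℝ (Fin d)) : polyFun p (r • w) = r ^ k * polyFun p w := by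
  simp only [polyFun, MvPolynomial.eval_eq', PiLp.smul_apply, smul_eq_mul, Finset.mul_sum]
  refine Finset.sum_congr rfl fun s hs => ?_
  have hk : k = ∑ i, s i := by
    rw [hp.degree_eq_sum_deg_support hs, ← Finsupp.sum_fintype s (fun _ n => n) (by simp), Finsupp.sum]
  rw [hk]
  simp only [mul_pow, Finset.prod_mul_distrib, Finset.prod_pow_eq_pow_sum]
  ring

lemma polyFun_polyDeriv_self {k : ℕ} {p : MvPolynomial (Fin d) ℝ} (hp : p.IsHomogeneous k)
    (w : EuclideanSpace ℝ (Fin d)) : polyFun (polyDeriv w p) w = k * polyFun p w := by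
  have h := congrArg (fun q => polyFun q w) hp.sum_X_mul_pderiv
  simp only [polyFun_sum, polyFun_mul, polyFun_X, nsmul_eq_mul] at h
  rw [polyDeriv_apply, polyFun_sum]
  simp only [polyFun_smul, h]
  congr 1
  simp [polyFun]

end PolyFun

/-! ### Gaussian integrals of harmonic polynomials -/

section GaussHarmonic

variable {d : ℕ}

lemma integrable_gauss_polyFun (p : MvPolynomial (Fin d) ℝ) :
    Integrable (fun w => gaussDensity w • polyFun p w) :=
  (polyGrowth_polyFun p).integrable_gauss

/-- The Gaussian integral as a linear functional on polynomials. -/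
def gaussInt (d : ℕ) : MvPolynomial (Fin d) ℝ →ₗ[ℝ] ℝ where
  toFun p := ∫ w, gaussDensity w • polyFun p w
  map_add' p q := by
    rw [← integral_add (integrable_gauss_polyFun p) (integrable_gauss_polyFun q)]
    simp [mul_add]
  map_smul' c p := by
    rw [RingHom.id_apply, smul_eq_mul, ← integral_const_mul]
    refine integral_congr_ae (.of_forall fun w => ?_)
    simp; ring

lemma gaussInt_apply (p : MvPolynomial (Fin d) ℝ) :
    gaussInt d p = ∫ w, gaussDensity w • polyFun p w := rfl

lemma gaussInt_X_mul (i : Fin d) (p : MvPolynomial (Fin d) ℝ) :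
    gaussInt d (MvPolynomial.X i * p) = gaussInt d (MvPolynomial.pderiv i p) := by
  have h := gauss_integral_inner_smul (EuclideanSpace.single i (1 : ℝ)) (polyGrowth_polyFun p)
    (polyGrowth_polyFun _) (fun w => hasLineDerivAt_polyFun p w _)
  rw [polyDeriv_single] at h
  rw [gaussInt_apply, gaussInt_apply, ← h]
  refine integral_congr_ae (.of_forall fun w => ?_)
  simp [EuclideanSpace.inner_single_left]

/-- Harmonic homogeneous polynomials are orthogonal to homogeneous polynomials of lower degree. -/
lemma gaussInt_mul_harmonic {m k : ℕ} (hmk : m < k) {q p : MvPolynomial (Fin d) ℝ}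
    (hq : q.IsHomogeneous m) (hp : p ∈ harmonicPoly d k) : gaussInt d (q * p) = 0 := by
  induction m generalizing k q p with
  | zero =>
    obtain ⟨hp1, hp2⟩ := mem_harmonicPoly.1 hp
    rw [← MvPolynomial.totalDegree_zero_iff_isHomogeneous,
      MvPolynomial.totalDegree_eq_zero_iff_eq_C] at hq
    have h : (k : ℝ) * gaussInt d (q * p) = 0 := by
      rw [← nsmul_eq_mul, ← map_nsmul, mul_comm q p, ← smul_mul_assoc,
        ← hp1.sum_X_mul_pderiv, Finset.sum_mul, map_sum]
      rw [hq]
      simp only [mul_assoc, gaussInt_X_mul]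
      simp only [MvPolynomial.pderiv_mul, MvPolynomial.pderiv_C, mul_zero, add_zero]
      rw [← map_sum, ← Finset.sum_mul, ← polyLaplacian_apply, hp2, zero_mul, map_zero]
    have hk : (k : ℝ) ≠ 0 := by exact_mod_cast (by omega : k ≠ 0)
    simpa [hk] using h
  | succ m ih =>
    obtain ⟨hp1, hp2⟩ := mem_harmonicPoly.1 hp
    have h : (k : ℝ) * gaussInt d (q * p) = 0 := by
      rw [← nsmul_eq_mul, ← map_nsmul, mul_comm q p, ← smul_mul_assoc,
        ← hp1.sum_X_mul_pderiv, Finset.sum_mul, map_sum]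
      simp only [mul_assoc, gaussInt_X_mul]
      simp only [MvPolynomial.pderiv_mul, map_add]
      rw [Finset.sum_add_distrib, ← map_sum, ← Finset.sum_mul, ← polyLaplacian_apply, hp2, zero_mul,
        map_zero, zero_add]
      refine Finset.sum_eq_zero fun i _ => ?_
      rw [mul_comm]
      exact ih (by omega) hq.pderiv (pderiv_mem_harmonicPoly i hp)
    have hk : (k : ℝ) ≠ 0 := by exact_mod_cast (by omega : k ≠ 0)
    simpa [hk] using h

/-- The Gaussian Fourier transform of a polynomial along the line spanned by `x`. -/
def gaussFourier (x : EuclideanSpace ℝ (Fin d)) (q : MvPolynomial (Fin d) ℝ) (s : ℝ) : ℂ :=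
  ∫ w, gaussDensity w • (Complex.exp (Complex.I * s * (⟪x, w⟫ : ℝ)) * (polyFun q w : ℂ))

lemma polyGrowth_ofReal {E : Type*} [NormedAddCommGroup E] [InnerProductSpace ℝ E] {F : E → ℝ}
    (hF : PolyGrowth F) : PolyGrowth (fun w => (F w : ℂ)) := by
  obtain ⟨h, C, k, hC⟩ := hF
  exact ⟨Complex.continuous_ofReal.comp h, C, k, fun w => by simpa using hC w⟩

lemma norm_exp_I_mul_mul (s t : ℝ) : ‖Complex.exp (Complex.I * s * (t : ℝ))‖ = 1 := by
  have : Complex.I * s * (t : ℝ) = ((s * t : ℝ) : ℂ) * Complex.I := by push_cast; ring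
  rw [this, Complex.norm_exp_ofReal_mul_I]

lemma polyGrowth_exp_inner (x : EuclideanSpace ℝ (Fin d)) (s : ℝ) :
    PolyGrowth (fun w : EuclideanSpace ℝ (Fin d) => Complex.exp (Complex.I * s * (⟪x, w⟫ : ℝ))) :=
  PolyGrowth.of_bounded (by fun_prop) (C := 1) fun w => (norm_exp_I_mul_mul _ _).le

lemma polyGrowth_exp_mul (x : EuclideanSpace ℝ (Fin d)) (s : ℝ) (q : MvPolynomial (Fin d) ℝ) :
    PolyGrowth (fun w => Complex.exp (Complex.I * s * (⟪x, w⟫ : ℝ)) * (polyFun q w : ℂ)) :=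
  (polyGrowth_exp_inner x s).smul (polyGrowth_ofReal (polyGrowth_polyFun q))

lemma hasLineDerivAt_exp_mul (x w : EuclideanSpace ℝ (Fin d)) (hx : ‖x‖ = 1) (s : ℝ)
    (q : MvPolynomial (Fin d) ℝ) :
    HasLineDerivAt ℝ (fun w => Complex.exp (Complex.I * s * (⟪x, w⟫ : ℝ)) * (polyFun q w : ℂ))
      (Complex.I * s * (Complex.exp (Complex.I * s * (⟪x, w⟫ : ℝ)) * (polyFun q w : ℂ)) +
        Complex.exp (Complex.I * s * (⟪x, w⟫ : ℝ)) * (polyFun (polyDeriv x q) w : ℂ)) w x := by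
  unfold HasLineDerivAt
  have h1 : HasDerivAt (fun t : ℝ => ((polyFun q (w + t • x) : ℝ) : ℂ))
      ((polyFun (polyDeriv x q) w : ℝ) : ℂ) 0 :=
    HasDerivAt.ofReal_comp (hasLineDerivAt_polyFun q w x)
  have h2 : HasDerivAt (fun t : ℝ => ((⟪x, w + t • x⟫ : ℝ) : ℂ)) 1 0 := by
    have : HasDerivAt (fun t : ℝ => ⟪x, w⟫ + t) 1 0 := (hasDerivAt_id (0 : ℝ)).const_add _
    have h3 := this.ofReal_comp
    simpa [inner_add_right, inner_smul_right, hx] using h3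
  have h3 := ((h2.const_mul (Complex.I * s)).cexp).mul h1
  simp only [zero_smul, add_zero, mul_one] at h3
  refine h3.congr_deriv ?_
  ring

lemma gaussFourier_hasDerivAt (x : EuclideanSpace ℝ (Fin d)) (hx : ‖x‖ = 1)
    (q : MvPolynomial (Fin d) ℝ) (s : ℝ) :
    HasDerivAt (gaussFourier x q)
      (-s * gaussFourier x q s + Complex.I * gaussFourier x (polyDeriv x q) s) s := by
  have hq := polyGrowth_ofReal (polyGrowth_polyFun q)
  have hx' := polyGrowth_inner x
  have key := hasDerivAt_integral_of_dominated_loc_of_deriv_le (μ := volume) (𝕜 := ℝ)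
    (F := fun (s : ℝ) w => gaussDensity w •
      (Complex.exp (Complex.I * s * (⟪x, w⟫ : ℝ)) * (polyFun q w : ℂ)))
    (F' := fun (s : ℝ) w => Complex.I * (gaussDensity w •
      (⟪x, w⟫ • (Complex.exp (Complex.I * s * (⟪x, w⟫ : ℝ)) * (polyFun q w : ℂ)))))
    (x₀ := s) (s := Set.univ) (bound := fun w => ‖gaussDensity w • (⟪x, w⟫ • (polyFun q w : ℂ))‖)
    Filter.univ_mem
    (.of_forall fun s => (polyGrowth_exp_mul x s q).integrable_gauss.aestronglyMeasurable)
    (polyGrowth_exp_mul x s q).integrable_gauss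
    ((hx'.smul (polyGrowth_exp_mul x s q)).integrable_gauss.aestronglyMeasurable.const_mul _)
    (.of_forall fun w t _ => ?_) ((hx'.smul hq).integrable_gauss.norm)
    (.of_forall fun w t _ => ?_)
  · refine key.2.congr_deriv ?_
    rw [integral_const_mul, gauss_integral_inner_smul x (polyGrowth_exp_mul x s q) ?_
      (fun w => hasLineDerivAt_exp_mul x w hx s q)]
    · simp only [smul_add]
      rw [integral_add]
      · have : ∀ w, gaussDensity w • (Complex.I * s *
            (Complex.exp (Complex.I * s * (⟪x, w⟫ : ℝ)) * (polyFun q w : ℂ))) =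
            (Complex.I * s) * (gaussDensity w •
              (Complex.exp (Complex.I * s * (⟪x, w⟫ : ℝ)) * (polyFun q w : ℂ))) := fun w => by
          rw [mul_smul_comm]
        simp only [this]
        rw [integral_const_mul]
        change Complex.I * (Complex.I * s * gaussFourier x q s + gaussFourier x (polyDeriv x q) s) = _
        linear_combination (s * gaussFourier x q s) * Complex.I_mul_I
      · exact ((PolyGrowth.of_bounded continuous_const (C := ‖Complex.I * s‖) (fun _ => le_rfl)).smul
          (polyGrowth_exp_mul x s q)).integrable_gauss
      · exact (polyGrowth_exp_mul x s _).integrable_gauss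
    · exact ((PolyGrowth.of_bounded continuous_const (C := ‖Complex.I * s‖) (fun _ => le_rfl)).smul
          (polyGrowth_exp_mul x s q)).add (polyGrowth_exp_mul x s _)
  · simp only [norm_mul, norm_smul, Complex.norm_I, one_mul, norm_exp_I_mul_mul]
    exact le_rfl
  · have h1 : HasDerivAt (fun s : ℝ => Complex.I * s * ((⟪x, w⟫ : ℝ) : ℂ))
        (Complex.I * 1 * ((⟪x, w⟫ : ℝ) : ℂ)) t :=
      ((Complex.ofRealCLM.hasDerivAt (x := t)).const_mul Complex.I).mul_const _
    have h2 := (h1.cexp.mul_const (polyFun q w : ℂ)).const_smul (gaussDensity w)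
    refine h2.congr_deriv ?_
    simp only [Complex.real_smul]
    ring

lemma gaussFourier_zero (x : EuclideanSpace ℝ (Fin d)) (q : MvPolynomial (Fin d) ℝ) :
    gaussFourier x q 0 = gaussInt d q := by
  rw [gaussFourier, gaussInt_apply, ← integral_complex_ofReal]
  refine integral_congr_ae (.of_forall fun w => ?_)
  simp

/-- The Gaussian version of the Funk-Hecke formula for the characters `w ↦ exp (i s ⟨x, w⟩)`. -/
theorem gaussFourier_harmonic (x : EuclideanSpace ℝ (Fin d)) (hx : ‖x‖ = 1) {k : ℕ}
    {q : MvPolynomial (Fin d) ℝ} (hq : q ∈ harmonicPoly d k) (s : ℝ) :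
    gaussFourier x q s =
      (Complex.I * s) ^ k * Real.exp (-s ^ 2 / 2) * polyFun q x * gaussInt d 1 := by
  have hexp (t : ℝ) : HasDerivAt (fun t : ℝ => ((Real.exp (t ^ 2 / 2) : ℝ) : ℂ))
      ((Real.exp (t ^ 2 / 2) * t : ℝ) : ℂ) t := by
    refine HasDerivAt.ofReal_comp ?_
    have : HasDerivAt (fun t : ℝ => t ^ 2 / 2) t t := by
      simpa using (hasDerivAt_pow 2 t).div_const 2
    exact this.exp
  have hinv (t : ℝ) : ((Real.exp (t ^ 2 / 2) : ℝ) : ℂ) * (Real.exp (-t ^ 2 / 2) : ℝ) = 1 := by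
    rw [← Complex.ofReal_mul, ← Real.exp_add]
    norm_num [neg_div]
  suffices h : ∀ s : ℝ, (Real.exp (s ^ 2 / 2) : ℂ) * gaussFourier x q s =
      (Complex.I * s) ^ k * polyFun q x * gaussInt d 1 by
    have h1 := h s
    have h2 := hinv s
    linear_combination (Real.exp (-s ^ 2 / 2) : ℂ) * h1 - gaussFourier x q s * h2
  clear s
  induction k generalizing q with
  | zero =>
    obtain ⟨c, rfl⟩ : ∃ c, q = MvPolynomial.C c := by
      have := (mem_harmonicPoly.1 hq).1
      rw [← MvPolynomial.totalDegree_zero_iff_isHomogeneous,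
        MvPolynomial.totalDegree_eq_zero_iff_eq_C] at this
      exact ⟨_, this⟩
    have h0 : polyDeriv x (MvPolynomial.C c) = 0 := by simp [polyDeriv_apply]
    have hz (t : ℝ) : gaussFourier x 0 t = 0 := by simp [gaussFourier]
    have hd (t : ℝ) : HasDerivAt (fun s : ℝ => (Real.exp (s ^ 2 / 2) : ℂ) *
        gaussFourier x (MvPolynomial.C c) s) 0 t := by
      refine ((hexp t).mul (gaussFourier_hasDerivAt x hx _ t)).congr_deriv ?_
      rw [h0, hz]
      push_cast
      ring
    intro s
    have h1 := is_const_of_deriv_eq_zero (fun t => (hd t).differentiableAt)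
      (fun t => (hd t).deriv) s 0
    rw [h1, gaussFourier_zero]
    have : gaussInt d (MvPolynomial.C c) = c * gaussInt d 1 := by
      rw [← smul_eq_mul, ← map_smul, MvPolynomial.smul_eq_C_mul, mul_one]
    simp [this]
  | succ k ih =>
    have hDq := polyDeriv_mem_harmonicPoly x hq
    rw [Nat.add_sub_cancel] at hDq
    have hE : polyFun (polyDeriv x q) x = ((k + 1 : ℕ) : ℝ) * polyFun q x :=
      polyFun_polyDeriv_self (mem_harmonicPoly.1 hq).1 x
    have hd (t : ℝ) : HasDerivAt (fun s : ℝ => (Real.exp (s ^ 2 / 2) : ℂ) *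
        gaussFourier x q s - (Complex.I * s) ^ (k + 1) * polyFun q x * gaussInt d 1) 0 t := by
      have h1 : HasDerivAt (fun s : ℝ => (Complex.I * s) ^ (k + 1) * polyFun q x * gaussInt d 1)
          (((k + 1 : ℕ) : ℂ) * (Complex.I * t) ^ k * (Complex.I * 1) * polyFun q x * gaussInt d 1)
          t := by
        have := ((Complex.ofRealCLM.hasDerivAt (x := t)).const_mul Complex.I).pow (k + 1)
        exact (this.mul_const _).mul_const _
      refine (((hexp t).mul (gaussFourier_hasDerivAt x hx _ t)).sub h1).congr_deriv ?_
      have h2 := ih hDq t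
      rw [hE] at h2
      push_cast at h2 ⊢
      linear_combination Complex.I * h2
    intro s
    have h1 := is_const_of_deriv_eq_zero (fun t => (hd t).differentiableAt)
      (fun t => (hd t).deriv) s 0
    have h0 : gaussInt d q = 0 := by
      have := gaussInt_mul_harmonic (Nat.succ_pos k) (MvPolynomial.isHomogeneous_one _ _) hq
      rwa [one_mul] at this
    simp only [gaussFourier_zero, h0] at h1
    rw [← sub_eq_zero, h1]
    simp

end GaussHarmonic

/-! ### The absolute value as a superposition of cosines -/

section AbsFourier

/-- The normalizing constant in `|t| = c⁻¹ ∫ (1 - cos (s t)) / s² ds`. -/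
def absFourierConst : ℝ := ∫ u : ℝ, (1 - Real.cos u) / u ^ 2

lemma integral_one_sub_cos_mul_div_sq (t : ℝ) :
    ∫ s : ℝ, (1 - Real.cos (s * t)) / s ^ 2 = absFourierConst * |t| := by
  rcases eq_or_ne t 0 with rfl | ht
  · simp
  · have h : ∀ s : ℝ, (1 - Real.cos (s * t)) / s ^ 2 =
        t ^ 2 * ((1 - Real.cos (s * t)) / (s * t) ^ 2) := fun s => by
      rcases eq_or_ne s 0 with rfl | hs
      · simp
      · field_simp
    simp only [h]
    rw [integral_const_mul, Measure.integral_comp_mul_right (fun u => (1 - Real.cos u) / u ^ 2) t]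
    rw [absFourierConst, smul_eq_mul, abs_inv, ← sq_abs t]
    have : |t| ≠ 0 := abs_ne_zero.2 ht
    field_simp

lemma one_sub_cos_mul_div_sq_le (s t : ℝ) :
    |(1 - Real.cos (s * t)) / s ^ 2| ≤ (2 + t ^ 2 / 2) * (1 + s ^ 2)⁻¹ := by
  rcases eq_or_ne s 0 with rfl | hs
  · simp; positivity
  have h1 : 0 ≤ 1 - Real.cos (s * t) := by linarith [Real.cos_le_one (s * t)]
  have h2 : 1 - Real.cos (s * t) ≤ 2 := by linarith [Real.neg_one_le_cos (s * t)]
  have h3 : 1 - Real.cos (s * t) ≤ (s * t) ^ 2 / 2 := by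
    linarith [Real.one_sub_sq_div_two_le_cos (x := s * t)]
  have hs2 : 0 < s ^ 2 := by positivity
  rw [abs_of_nonneg (by positivity), ← div_eq_mul_inv, div_le_div_iff₀ hs2 (by positivity)]
  nlinarith

variable {d : ℕ}

lemma re_gaussFourier (x : EuclideanSpace ℝ (Fin d)) (q : MvPolynomial (Fin d) ℝ) (s : ℝ) :
    (gaussFourier x q s).re = ∫ w, gaussDensity w • (Real.cos (s * ⟪x, w⟫) * polyFun q w) := by
  rw [gaussFourier, ← RCLike.re_eq_complex_re, ← integral_re (polyGrowth_exp_mul x s q).integrable_gauss]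
  refine integral_congr_ae (.of_forall fun w => ?_)
  have : Complex.I * s * ((⟪x, w⟫ : ℝ) : ℂ) = ((s * ⟪x, w⟫ : ℝ) : ℂ) * Complex.I := by
    push_cast; ring
  simp only [this, RCLike.re_eq_complex_re, Complex.smul_re, Complex.re_mul_ofReal,
    Complex.exp_ofReal_mul_I_re]

lemma polyGrowth_cos_mul (x : EuclideanSpace ℝ (Fin d)) (q : MvPolynomial (Fin d) ℝ) (s : ℝ) :
    PolyGrowth (fun w => Real.cos (s * ⟪x, w⟫) * polyFun q w) :=
  (PolyGrowth.of_bounded (F := fun w => Real.cos (s * ⟪x, w⟫)) (C := 1) (by fun_prop)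
    (fun w => Real.abs_cos_le_one _)).smul (polyGrowth_polyFun q)

lemma absFourierConst_mul_gauss_abs (x : EuclideanSpace ℝ (Fin d)) (q : MvPolynomial (Fin d) ℝ) :
    absFourierConst * ∫ w, gaussDensity w • (|⟪x, w⟫| * polyFun q w) =
      ∫ s : ℝ, (gaussInt d q - (gaussFourier x q s).re) / s ^ 2 := by
  have hint : Integrable (Function.uncurry fun (w : EuclideanSpace ℝ (Fin d)) (s : ℝ) =>
      gaussDensity w • (polyFun q w * ((1 - Real.cos (s * ⟪x, w⟫)) / s ^ 2)))
      (volume.prod volume) := by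
    have hg : PolyGrowth (fun w : EuclideanSpace ℝ (Fin d) =>
        polyFun q w * (2 + ⟪x, w⟫ * ⟪x, w⟫ * (1 / 2))) :=
      (polyGrowth_polyFun q).smul ((PolyGrowth.of_bounded continuous_const (C := ‖(2 : ℝ)‖)
        (fun _ => le_rfl)).add (((polyGrowth_inner x).smul (polyGrowth_inner x)).smul
        (PolyGrowth.of_bounded continuous_const (C := ‖(1 / 2 : ℝ)‖) (fun _ => le_rfl))))
    refine (hg.integrable_gauss.norm.mul_prod integrable_inv_one_add_sq).mono' ?_
      (.of_forall fun z => ?_)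
    · refine Measurable.aestronglyMeasurable ?_
      have h1 : Measurable fun z : EuclideanSpace ℝ (Fin d) × ℝ => gaussDensity z.1 :=
        (continuous_gaussDensity.comp continuous_fst).measurable
      have h2 : Measurable fun z : EuclideanSpace ℝ (Fin d) × ℝ => polyFun q z.1 :=
        ((continuous_polyFun q).comp continuous_fst).measurable
      have h3 : Measurable fun z : EuclideanSpace ℝ (Fin d) × ℝ => 1 - Real.cos (z.2 * ⟪x, z.1⟫) :=
        Continuous.measurable (by fun_prop)
      exact h1.smul (h2.mul (h3.div (measurable_snd.pow_const 2)))
    · obtain ⟨w, s⟩ := z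
      simp only [Function.uncurry, smul_eq_mul, norm_mul, mul_assoc]
      gcongr
      have h2 : 2 + ⟪x, w⟫ * (⟪x, w⟫ * (1 / 2)) = 2 + ⟪x, w⟫ ^ 2 / 2 := by ring
      rw [Real.norm_eq_abs, Real.norm_eq_abs, h2, abs_of_nonneg (a := 2 + _) (by positivity)]
      exact one_sub_cos_mul_div_sq_le s ⟪x, w⟫
  have hswap := integral_integral_swap hint
  rw [← integral_const_mul]
  trans ∫ w : EuclideanSpace ℝ (Fin d), ∫ s : ℝ,
      gaussDensity w • (polyFun q w * ((1 - Real.cos (s * ⟪x, w⟫)) / s ^ 2))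
  · refine integral_congr_ae (.of_forall fun w => ?_)
    simp only [smul_eq_mul]
    rw [integral_const_mul, integral_const_mul, integral_one_sub_cos_mul_div_sq]
    ring
  rw [hswap]
  refine integral_congr_ae (.of_forall fun s => ?_)
  simp only
  rw [re_gaussFourier, gaussInt_apply, ← integral_sub (integrable_gauss_polyFun q)
    (polyGrowth_cos_mul x q s).integrable_gauss, ← integral_div]
  refine integral_congr_ae (.of_forall fun w => ?_)
  simp only [smul_eq_mul]
  ring

/-- The radial Gaussian moments. -/
def radialMoment (n : ℕ) : ℝ := ∫ r in Set.Ioi (0 : ℝ), r ^ n * Real.exp (-r ^ 2 / 2)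

lemma integrable_pow_mul_exp (n : ℕ) :
    Integrable (fun r : ℝ => r ^ n * Real.exp (-r ^ 2 / 2)) := by
  have h := integrable_rpow_mul_exp_neg_mul_sq (b := 1 / 2) (by norm_num) (s := n)
    (by have := n.cast_nonneg (α := ℝ); linarith)
  refine h.congr (.of_forall fun r => ?_)
  simp only [Real.rpow_natCast]
  congr 2
  ring

lemma radialMoment_pos (n : ℕ) : 0 < radialMoment n := by
  unfold radialMoment
  rw [setIntegral_pos_iff_support_of_nonneg_ae]
  · have : Set.Ioi (0 : ℝ) ⊆ (Function.support fun r : ℝ => r ^ n * Real.exp (-r ^ 2 / 2)) ∩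
        Set.Ioi 0 := fun r hr => ⟨(mul_pos (pow_pos hr n) (Real.exp_pos _)).ne', hr⟩
    exact lt_of_lt_of_le (by simp) (measure_mono this)
  · filter_upwards [ae_restrict_mem measurableSet_Ioi] with r hr
    exact (mul_pos (pow_pos hr n) (Real.exp_pos _)).le
  · exact (integrable_pow_mul_exp n).integrableOn

lemma integral_even_pow_mul_exp (j : ℕ) :
    ∫ s : ℝ, s ^ (2 * j) * Real.exp (-s ^ 2 / 2) = 2 * radialMoment (2 * j) := by
  have h := integral_comp_abs (f := fun s : ℝ => s ^ (2 * j) * Real.exp (-s ^ 2 / 2))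
  rw [radialMoment, ← h]
  refine integral_congr_ae (.of_forall fun s => ?_)
  simp [pow_mul]

/-- The constant governing the action of the cosine transform on constants. -/
def absFourierConstZero : ℝ := ∫ s : ℝ, (1 - Real.exp (-s ^ 2 / 2)) / s ^ 2

lemma absFourierConstZero_pos : 0 < absFourierConstZero := by
  have hb (s : ℝ) : 0 ≤ (1 - Real.exp (-s ^ 2 / 2)) ∧
      (1 - Real.exp (-s ^ 2 / 2)) ≤ 1 ∧ (1 - Real.exp (-s ^ 2 / 2)) ≤ s ^ 2 / 2 := by
    refine ⟨?_, ?_, ?_⟩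
    · rw [sub_nonneg, Real.exp_le_one_iff]; nlinarith [sq_nonneg s]
    · linarith [Real.exp_pos (-s ^ 2 / 2)]
    · linarith [Real.add_one_le_exp (-s ^ 2 / 2)]
  unfold absFourierConstZero
  rw [integral_pos_iff_support_of_nonneg]
  · have : Set.Ioi (0 : ℝ) ⊆
        (Function.support fun s : ℝ => (1 - Real.exp (-s ^ 2 / 2)) / s ^ 2) := fun s hs => by
      have hs : 0 < s := hs
      have h1 : Real.exp (-s ^ 2 / 2) < 1 := by
        rw [Real.exp_lt_one_iff]; nlinarith
      exact (div_pos (sub_pos.2 h1) (by positivity)).ne'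
    exact lt_of_lt_of_le (by simp) (measure_mono this)
  · intro s
    exact div_nonneg (hb s).1 (sq_nonneg s)
  · refine (integrable_inv_one_add_sq.const_mul 2).mono' ?_ (.of_forall fun s => ?_)
    · exact Measurable.aestronglyMeasurable (by fun_prop)
    · obtain ⟨h1, h2, h3⟩ := hb s
      rcases eq_or_ne s 0 with rfl | hs
      · simp
      rw [Real.norm_of_nonneg (div_nonneg h1 (sq_nonneg s)), ← div_eq_mul_inv,
        div_le_div_iff₀ (by positivity) (by positivity)]
      nlinarith

/-- The value at `k` of the Gaussian cosine-transform multiplier, up to `absFourierConst`. -/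
def gaussAbsMult : ℕ → ℝ
  | 0 => absFourierConstZero
  | k + 1 => (-1) ^ ((k + 1) / 2 + 1) * (2 * radialMoment (k + 1 - 2))

theorem gauss_abs_mul_harmonic (x : EuclideanSpace ℝ (Fin d)) (hx : ‖x‖ = 1) {k : ℕ}
    (hk : Even k) {q : MvPolynomial (Fin d) ℝ} (hq : q ∈ harmonicPoly d k) :
    absFourierConst * ∫ w, gaussDensity w • (|⟪x, w⟫| * polyFun q w) =
      gaussAbsMult k * polyFun q x * gaussInt d 1 := by
  obtain ⟨j, rfl⟩ := even_iff_exists_two_mul.1 hk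
  have hre (s : ℝ) : (gaussFourier x q s).re =
      (-1) ^ j * s ^ (2 * j) * Real.exp (-s ^ 2 / 2) * polyFun q x * gaussInt d 1 := by
    rw [gaussFourier_harmonic x hx hq]
    have : (Complex.I * s) ^ (2 * j) * Real.exp (-s ^ 2 / 2) * polyFun q x * gaussInt d 1 =
        (((-1) ^ j * s ^ (2 * j) * Real.exp (-s ^ 2 / 2) * polyFun q x * gaussInt d 1 : ℝ) : ℂ) := by
      push_cast
      rw [mul_pow, pow_mul Complex.I, Complex.I_sq]
    rw [this, Complex.ofReal_re]
  rw [absFourierConst_mul_gauss_abs]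
  simp only [hre]
  rcases j with _ | j
  · have hC : gaussInt d q = polyFun q x * gaussInt d 1 := by
      obtain ⟨c, rfl⟩ : ∃ c, q = MvPolynomial.C c := by
        have := (mem_harmonicPoly.1 hq).1
        rw [mul_zero, ← MvPolynomial.totalDegree_zero_iff_isHomogeneous,
          MvPolynomial.totalDegree_eq_zero_iff_eq_C] at this
        exact ⟨_, this⟩
      rw [polyFun_C, ← smul_eq_mul, ← map_smul, MvPolynomial.smul_eq_C_mul, mul_one]
    simp only [gaussAbsMult, absFourierConstZero, mul_zero]
    rw [hC, ← integral_mul_const, ← integral_mul_const]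
    refine integral_congr_ae (.of_forall fun s => ?_)
    simp only [pow_zero]
    ring
  · have h0 : gaussInt d q = 0 := by
      have := gaussInt_mul_harmonic (by omega : 0 < 2 * (j + 1))
        (MvPolynomial.isHomogeneous_one _ _) hq
      rwa [one_mul] at this
    have hm : gaussAbsMult (2 * (j + 1)) = (-1) ^ j * (2 * radialMoment (2 * j)) := by
      have h1 : (2 * j + 1 + 1) / 2 + 1 = j + 2 := by omega
      have h2 : 2 * j + 1 + 1 - 2 = 2 * j := by omega
      change (-1) ^ ((2 * j + 1 + 1) / 2 + 1) * (2 * radialMoment (2 * j + 1 + 1 - 2)) = _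
      rw [h1, h2]
      ring
    rw [h0, hm, ← integral_even_pow_mul_exp, ← integral_const_mul, ← integral_mul_const,
      ← integral_mul_const]
    have hne : ∀ᵐ s : ℝ, s ≠ 0 := by simp [ae_iff]
    refine integral_congr_ae ?_
    filter_upwards [hne] with s hs
    field_simp
    ring

end AbsFourier

/-! ### Polar coordinates and the Funk-Hecke formula for the absolute value -/

section Polar

variable {d : ℕ}

lemma integral_volumeIoiPow (n : ℕ) (g : ℝ → ℝ) :
    ∫ r : Set.Ioi (0 : ℝ), g r ∂(Measure.volumeIoiPow n) =
      ∫ r in Set.Ioi (0 : ℝ), r ^ n * g r := by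
  simp only [Measure.volumeIoiPow, ENNReal.ofReal]
  rw [integral_withDensity_eq_integral_smul,
    integral_subtype_comap measurableSet_Ioi fun a ↦ Real.toNNReal (a ^ n) • g a,
    setIntegral_congr_fun measurableSet_Ioi fun x hx ↦ ?_]
  · rw [NNReal.smul_def, Real.coe_toNNReal _ (pow_nonneg (Set.mem_Ioi.1 hx).le _), smul_eq_mul]
  · exact (measurable_subtype_coe.pow_const _).real_toNNReal

lemma integral_gauss_homogeneous (hd : d ≠ 0) {m : ℕ} {F : EuclideanSpace ℝ (Fin d) → ℝ}
    (hF : ∀ r : ℝ, 0 < r → ∀ w, F (r • w) = r ^ m * F w) :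
    ∫ w, gaussDensity w • F w = radialMoment (d - 1 + m) *
      ∫ x : USphere d, F x ∂((volume : Measure (EuclideanSpace ℝ (Fin d))).toSphere) := by
  have : NeZero d := ⟨hd⟩
  set μ : Measure (EuclideanSpace ℝ (Fin d)) := volume
  calc ∫ w, gaussDensity w • F w
      = ∫ w : ({(0 : EuclideanSpace ℝ (Fin d))}ᶜ : Set _), gaussDensity w.1 • F w.1
          ∂(μ.comap (↑)) := by
        rw [integral_subtype_comap (measurableSet_singleton _).compl
          fun w => gaussDensity w • F w, restrict_compl_singleton]
    _ = ∫ z, F z.1 * (z.2.1 ^ m * Real.exp (-z.2.1 ^ 2 / 2))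
          ∂(μ.toSphere.prod (Measure.volumeIoiPow (d - 1))) := by
        have h := (μ.measurePreserving_homeomorphUnitSphereProd).integral_comp
          (Homeomorph.measurableEmbedding _)
          (fun z : USphere d × Set.Ioi (0 : ℝ) => F z.1 * (z.2.1 ^ m * Real.exp (-z.2.1 ^ 2 / 2)))
        rw [finrank_euclideanSpace_fin] at h
        rw [← h]
        refine integral_congr_ae (.of_forall fun w => ?_)
        have hw : 0 < ‖w.1‖ := norm_pos_iff.2 w.2
        have hw' : w.1 = ‖w.1‖ • (‖w.1‖⁻¹ • w.1) := by
          rw [smul_smul, mul_inv_cancel₀ hw.ne', one_smul]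
        have h1 : F w.1 = ‖w.1‖ ^ m * F (‖w.1‖⁻¹ • w.1) := by
          conv_lhs => rw [hw', hF _ hw]
        simp only [smul_eq_mul, h1, gaussDensity, homeomorphUnitSphereProd_apply_fst_coe,
          homeomorphUnitSphereProd_apply_snd_coe]
        ring
    _ = _ := by
        rw [integral_prod_mul (fun x : USphere d => F x)
          (fun r : Set.Ioi (0 : ℝ) => r.1 ^ m * Real.exp (-r.1 ^ 2 / 2)),
          integral_volumeIoiPow (d - 1) (fun r => r ^ m * Real.exp (-r ^ 2 / 2)), mul_comm]
        congr 1
        refine integral_congr_ae (.of_forall fun r => ?_)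
        simp only [pow_add]
        ring

lemma integral_uniformSphere (g : USphere d → ℝ) :
    ∫ x, g x ∂(uniformSphere d) =
      ((volume : Measure (EuclideanSpace ℝ (Fin d))).toSphere.real Set.univ)⁻¹ *
        ∫ x, g x ∂((volume : Measure (EuclideanSpace ℝ (Fin d))).toSphere) := by
  rw [uniformSphere, integral_smul_measure, smul_eq_mul, ENNReal.toReal_inv, Measure.real]

lemma toSphere_real_univ_pos (hd : d ≠ 0) :
    0 < (volume : Measure (EuclideanSpace ℝ (Fin d))).toSphere.real Set.univ := by
  have : NeZero d := ⟨hd⟩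
  rw [Measure.real, ENNReal.toReal_pos_iff]
  refine ⟨?_, measure_lt_top _ _⟩
  rw [pos_iff_ne_zero, Measure.measure_univ_ne_zero]
  exact Measure.toSphere_ne_zero _

lemma gaussInt_one_eq (hd : d ≠ 0) :
    gaussInt d 1 = radialMoment (d - 1) *
      (volume : Measure (EuclideanSpace ℝ (Fin d))).toSphere.real Set.univ := by
  have h := integral_gauss_homogeneous hd (m := 0) (F := fun _ => 1) (by simp)
  rw [gaussInt_apply]
  simpa [polyFun] using h

lemma gaussInt_one_pos (hd : d ≠ 0) : 0 < gaussInt d 1 := by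
  rw [gaussInt_one_eq hd]
  exact mul_pos (radialMoment_pos _) (toSphere_real_univ_pos hd)

/-- Gaussian integrals of homogeneous functions in terms of averages over the sphere. -/
lemma radialMoment_mul_integral_gauss (hd : d ≠ 0) {m : ℕ} {F : EuclideanSpace ℝ (Fin d) → ℝ}
    (hF : ∀ r : ℝ, 0 < r → ∀ w, F (r • w) = r ^ m * F w) :
    radialMoment (d - 1) * ∫ w, gaussDensity w • F w =
      radialMoment (d - 1 + m) * gaussInt d 1 * ∫ x : USphere d, F x ∂(uniformSphere d) := by
  rw [integral_gauss_homogeneous hd hF, gaussInt_one_eq hd, integral_uniformSphere]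
  have := (toSphere_real_univ_pos hd).ne'
  field_simp

lemma absFourierConst_pos : 0 < absFourierConst := by
  have h0 : 0 ≤ absFourierConst := integral_nonneg fun u =>
    div_nonneg (by linarith [Real.cos_le_one u]) (sq_nonneg u)
  refine lt_of_le_of_ne h0 fun h => ?_
  have h1 := gauss_abs_mul_harmonic (EuclideanSpace.single (0 : Fin 1) (1 : ℝ)) (by simp)
    (k := 0) (by simp) (q := 1) (mem_harmonicPoly.2 ⟨MvPolynomial.isHomogeneous_one _ _, by
      simp [polyLaplacian_apply]⟩)
  rw [← h, zero_mul] at h1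
  have h2 : polyFun 1 (EuclideanSpace.single (0 : Fin 1) (1 : ℝ)) = 1 := by simp [polyFun]
  rw [h2, gaussAbsMult] at h1
  have := mul_pos absFourierConstZero_pos (gaussInt_one_pos (d := 1) one_ne_zero)
  linarith

/-- The Funk-Hecke multiplier of the absolute value in degree `k`, for `k` even. -/
def absMult (d k : ℕ) : ℝ :=
  gaussAbsMult k * radialMoment (d - 1) / (absFourierConst * radialMoment (d - 1 + (k + 1)))

/-- The Funk-Hecke formula for the absolute value. -/
theorem integral_abs_mul_harmonic (hd : d ≠ 0) (x : EuclideanSpace ℝ (Fin d)) (hx : ‖x‖ = 1)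
    {k : ℕ} (hk : Even k) {q : MvPolynomial (Fin d) ℝ} (hq : q ∈ harmonicPoly d k) :
    ∫ w : USphere d, |⟪x, w⟫| * polyFun q w ∂(uniformSphere d) = absMult d k * polyFun q x := by
  have h1 := gauss_abs_mul_harmonic x hx hk hq
  have h2 := radialMoment_mul_integral_gauss hd (m := k + 1) (F := fun w => |⟪x, w⟫| * polyFun q w)
    (fun r hr w => by
      rw [polyFun_smul_arg (mem_harmonicPoly.1 hq).1, inner_smul_right, abs_mul, abs_of_pos hr]
      ring)
  have h3 := (radialMoment_pos (d - 1 + (k + 1))).ne'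
  have h4 := absFourierConst_pos.ne'
  have h5 := (gaussInt_one_pos hd).ne'
  rw [absMult, div_mul_eq_mul_div, eq_div_iff (mul_ne_zero h4 h3)]
  refine mul_left_cancel₀ h5 ?_
  linear_combination radialMoment (d - 1) * h1 - absFourierConst * h2

end Polar

/-! ### Radial moments -/

section Moments

lemma radialMoment_add_two (n : ℕ) : radialMoment (n + 2) = (n + 1) * radialMoment n := by
  have hform (m : ℕ) : radialMoment m =
      (1 / 2 : ℝ) ^ (-((m : ℝ) + 1) / 2) * (1 / 2) * Real.Gamma (((m : ℝ) + 1) / 2) := by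
    have h := integral_rpow_mul_exp_neg_mul_rpow (p := 2) (q := m) (b := 1 / 2) (by norm_num)
      (by have := m.cast_nonneg (α := ℝ); linarith) (by norm_num)
    rw [← h, radialMoment]
    refine integral_congr_ae (.of_forall fun r => ?_)
    simp only [Real.rpow_natCast, Real.rpow_ofNat]
    congr 2
    ring
  rw [hform, hform]
  have h1 : (((n + 2 : ℕ) : ℝ) + 1) / 2 = ((n : ℝ) + 1) / 2 + 1 := by push_cast; ring
  have h2 : -(((n + 2 : ℕ) : ℝ) + 1) / 2 = -((n : ℝ) + 1) / 2 + (-1) := by push_cast; ring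
  rw [h1, h2, Real.Gamma_add_one (by positivity), Real.rpow_add (by norm_num),
    Real.rpow_neg_one]
  ring

lemma radialMoment_succ_sq_le (n : ℕ) :
    radialMoment (n + 1) ^ 2 ≤ radialMoment n * radialMoment (n + 2) := by
  have h0 := radialMoment_pos n
  set a := radialMoment (n + 1) / radialMoment n with ha
  have key : 0 ≤ radialMoment (n + 2) - 2 * a * radialMoment (n + 1) + a ^ 2 * radialMoment n := by
    have h1 : radialMoment (n + 2) - 2 * a * radialMoment (n + 1) + a ^ 2 * radialMoment n =
        ∫ r in Set.Ioi (0 : ℝ), r ^ n * Real.exp (-r ^ 2 / 2) * (r - a) ^ 2 := by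
      unfold radialMoment
      rw [← integral_const_mul, ← integral_const_mul, ← integral_sub, ← integral_add]
      · refine integral_congr_ae (.of_forall fun r => ?_)
        simp only
        ring
      · exact ((integrable_pow_mul_exp (n + 2)).sub
          ((integrable_pow_mul_exp (n + 1)).const_mul _)).integrableOn
      · exact ((integrable_pow_mul_exp n).const_mul _).integrableOn
      · exact (integrable_pow_mul_exp (n + 2)).integrableOn
      · exact ((integrable_pow_mul_exp (n + 1)).const_mul _).integrableOn
    rw [h1]
    refine setIntegral_nonneg measurableSet_Ioi fun r hr => ?_
    have hr : 0 < r := hr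
    positivity
  have h2 : a * radialMoment n = radialMoment (n + 1) := by rw [ha]; field_simp
  have h3 : 0 ≤ (radialMoment (n + 2) - 2 * a * radialMoment (n + 1) + a ^ 2 * radialMoment n) *
      radialMoment n := mul_nonneg key h0.le
  nlinarith

/-- Ratios of successive radial moments. -/
def momentRatio (n : ℕ) : ℝ := radialMoment (n + 1) / radialMoment n

lemma momentRatio_pos (n : ℕ) : 0 < momentRatio n :=
  div_pos (radialMoment_pos _) (radialMoment_pos _)

lemma momentRatio_monotone : Monotone momentRatio := by
  refine monotone_nat_of_le_succ fun n => ?_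
  unfold momentRatio
  rw [div_le_div_iff₀ (radialMoment_pos _) (radialMoment_pos _)]
  have := radialMoment_succ_sq_le n
  nlinarith

lemma momentRatio_mul_succ (n : ℕ) : momentRatio n * momentRatio (n + 1) = n + 1 := by
  unfold momentRatio
  have h1 := (radialMoment_pos n).ne'
  have h2 := (radialMoment_pos (n + 1)).ne'
  rw [show n + 1 + 1 = n + 2 from rfl, radialMoment_add_two]
  field_simp

lemma momentRatio_le (n : ℕ) : momentRatio n ≤ n + 1 := by
  have h1 : momentRatio n ^ 2 ≤ n + 1 := by
    rw [← momentRatio_mul_succ n, sq]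
    exact mul_le_mul_of_nonneg_left (momentRatio_monotone n.le_succ) (momentRatio_pos n).le
  have h2 : (0 : ℝ) ≤ n := n.cast_nonneg
  nlinarith [momentRatio_pos n]

/-- The constant in `radialMoment n * radialMoment (n + 1) = c * n!`. -/
def momentConst : ℝ := radialMoment 0 * radialMoment 1

lemma momentConst_pos : 0 < momentConst := mul_pos (radialMoment_pos _) (radialMoment_pos _)

lemma radialMoment_mul_succ (n : ℕ) :
    radialMoment n * radialMoment (n + 1) = momentConst * n.factorial := by
  induction n with
  | zero => simp [momentConst]
  | succ n ih =>
    rw [show n + 1 + 1 = n + 2 from rfl, radialMoment_add_two, Nat.factorial_succ]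
    push_cast
    linear_combination ((n : ℝ) + 1) * ih

lemma momentRatio_mul_radialMoment_sq (n : ℕ) :
    momentRatio n * radialMoment n ^ 2 = momentConst * n.factorial := by
  rw [← radialMoment_mul_succ, momentRatio]
  have := (radialMoment_pos n).ne'
  field_simp

/-- The lower bound for the ratio of moments appearing in the Funk-Hecke multiplier. -/
lemma le_radialMoment_ratio (e j : ℕ) :
    momentConst * (e + 1).factorial * j.factorial / ((e + 2) * (e + j + 4).factorial) ≤
      (radialMoment (e + 1) * radialMoment j / radialMoment (e + j + 4)) ^ 2 := by
  have ha := momentRatio_mul_radialMoment_sq (e + 1)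
  have hb := momentRatio_mul_radialMoment_sq j
  have hc := momentRatio_mul_radialMoment_sq (e + j + 4)
  have pa := momentRatio_pos (e + 1)
  have pb := momentRatio_pos j
  have pc := momentRatio_pos (e + j + 4)
  have hκ := momentConst_pos
  have h1 : momentRatio j ≤ momentRatio (e + j + 4) := momentRatio_monotone (by omega)
  have h2 : momentRatio (e + 1) ≤ e + 2 := by
    have := momentRatio_le (e + 1)
    push_cast at this
    linarith
  have ea : radialMoment (e + 1) ^ 2 = momentConst * (e + 1).factorial / momentRatio (e + 1) := by
    rw [eq_div_iff pa.ne', ← ha]; ring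
  have eb : radialMoment j ^ 2 = momentConst * j.factorial / momentRatio j := by
    rw [eq_div_iff pb.ne', ← hb]; ring
  have ec : radialMoment (e + j + 4) ^ 2 =
      momentConst * (e + j + 4).factorial / momentRatio (e + j + 4) := by
    rw [eq_div_iff pc.ne', ← hc]; ring
  rw [div_pow, mul_pow, ea, eb, ec]
  have f1 : (0 : ℝ) < (e + 1).factorial := by positivity
  have f2 : (0 : ℝ) < j.factorial := by positivity
  have f3 : (0 : ℝ) < (e + j + 4).factorial := by positivity
  rw [show momentConst * ((e + 1).factorial : ℝ) / momentRatio (e + 1) *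
      (momentConst * (j.factorial : ℝ) / momentRatio j) /
      (momentConst * ((e + j + 4).factorial : ℝ) / momentRatio (e + j + 4)) =
      (momentConst * (e + 1).factorial * j.factorial / (e + j + 4).factorial) *
      (momentRatio (e + j + 4) / momentRatio j) * (1 / momentRatio (e + 1)) by field_simp,
    show momentConst * ((e + 1).factorial : ℝ) * j.factorial / ((e + 2) * (e + j + 4).factorial) =
      (momentConst * (e + 1).factorial * j.factorial / (e + j + 4).factorial) * 1 *
      (1 / ((e : ℝ) + 2)) by field_simp]
  gcongr
  rwa [one_le_div pb]

end Moments

/-! ### Dimensions of spaces of harmonic polynomials -/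

section Dimension

variable {d : ℕ}

lemma finrank_homogeneousSubmodule (d k : ℕ) :
    Module.finrank ℝ (MvPolynomial.homogeneousSubmodule (Fin d) ℝ k) = (d + k - 1).choose k := by
  rw [MvPolynomial.homogeneousSubmodule_eq_finsupp_supported,
    (AddMonoidAlgebra.supportedEquivFinsupp {s : Fin d →₀ ℕ | s.degree = k}).finrank_eq]
  have hset : {s : Fin d →₀ ℕ | s.degree = k} =
      ((Finset.univ : Finset (Fin d)).finsuppAntidiag k : Set (Fin d →₀ ℕ)) := by
    ext s
    simp [Finset.mem_finsuppAntidiag, Finsupp.degree_eq_sum]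
  rw [hset, Module.finrank_finsupp_self]
  refine (Fintype.card_congr (Equiv.refl _)).trans ((Fintype.card_coe
    ((Finset.univ : Finset (Fin d)).finsuppAntidiag k)).trans ?_)
  rw [Finset.card_finsuppAntidiag_nat_eq_choose, Finset.card_univ, Fintype.card_fin]

lemma isHomogeneous_polyLaplacian {k : ℕ} {p : MvPolynomial (Fin d) ℝ} (hp : p.IsHomogeneous k) :
    (polyLaplacian d p).IsHomogeneous (k - 2) := by
  rw [polyLaplacian_apply]
  exact MvPolynomial.IsHomogeneous.sum _ _ _ fun i _ => hp.pderiv.pderiv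

lemma finiteDimensional_homogeneous (d k : ℕ) :
    FiniteDimensional ℝ (MvPolynomial.homogeneousSubmodule (Fin d) ℝ k) :=
  Module.Finite.iff_fg.mpr (MvPolynomial.homogeneousSubmodule_fg (σ := Fin d) (R := ℝ) k)

lemma finrank_homogeneous_le (d k : ℕ) :
    Module.finrank ℝ (MvPolynomial.homogeneousSubmodule (Fin d) ℝ k) ≤
      Module.finrank ℝ (MvPolynomial.homogeneousSubmodule (Fin d) ℝ (k - 2)) +
        Module.finrank ℝ (harmonicPoly d k) := by
  have := finiteDimensional_homogeneous d k
  have := finiteDimensional_homogeneous d (k - 2)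
  set V := MvPolynomial.homogeneousSubmodule (Fin d) ℝ k
  set W := MvPolynomial.homogeneousSubmodule (Fin d) ℝ (k - 2)
  let L : V →ₗ[ℝ] W := (polyLaplacian d).restrict fun p hp => isHomogeneous_polyLaplacian hp
  have h1 := LinearMap.finrank_range_add_finrank_ker L
  have h2 : Module.finrank ℝ (LinearMap.range L) ≤ Module.finrank ℝ W := Submodule.finrank_le _
  have h3 : (LinearMap.ker L).map V.subtype ≤ harmonicPoly d k := by
    rintro _ ⟨p, hp, rfl⟩
    refine ⟨p.2, ?_⟩
    have : L p = 0 := hp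
    exact congrArg Subtype.val this
  have h4 : Module.finrank ℝ (LinearMap.ker L) ≤ Module.finrank ℝ (harmonicPoly d k) := by
    rw [← Submodule.finrank_map_subtype_eq V (LinearMap.ker L)]
    exact Submodule.finrank_mono h3
  omega

lemma choose_le_finrank_harmonicPoly (e j : ℕ) :
    (e + j + 2).choose (j + 2) ≤ Module.finrank ℝ (harmonicPoly (e + 2) (j + 2)) := by
  have h := finrank_homogeneous_le (e + 2) (j + 2)
  rw [finrank_homogeneousSubmodule, finrank_homogeneousSubmodule] at h
  rw [show e + 2 + (j + 2) - 1 = (e + j + 2) + 1 by omega, Nat.choose_succ_succ',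
    show e + 2 + (j + 2 - 2) - 1 = e + j + 1 by omega, show j + 2 - 2 = j by omega, show j + 1 + 1 = j + 2 from rfl] at h
  have h2 : (e + j + 1).choose j ≤ (e + j + 2).choose (j + 1) := by
    rw [show e + j + 2 = (e + j + 1) + 1 from rfl, Nat.choose_succ_succ']
    omega
  omega

end Dimension

/-! ### Restriction of polynomials to the sphere -/

section Restriction

variable {d : ℕ}

lemma restrictToSphere_apply (p : MvPolynomial (Fin d) ℝ) (x : USphere d) :
    restrictToSphere d p x = polyFun p x := rfl

instance instNonemptyUSphere [NeZero d] : Nonempty (USphere d) :=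
  (NormedSpace.sphere_nonempty (E := EuclideanSpace ℝ (Fin d))).2 zero_le_one |>.to_subtype

lemma eq_zero_of_polyFun_sphere_eq_zero [NeZero d] {k : ℕ} {p : MvPolynomial (Fin d) ℝ}
    (hp : p.IsHomogeneous k) (h : ∀ x : USphere d, polyFun p x = 0) : p = 0 := by
  have h1 : ∀ w, polyFun p w = 0 := fun w => by
    rcases eq_or_ne w 0 with rfl | hw
    · obtain ⟨e⟩ := instNonemptyUSphere (d := d)
      have := polyFun_smul_arg hp 0 (e : EuclideanSpace ℝ (Fin d))
      rwa [zero_smul, h, mul_zero] at this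
    · have hw0 : ‖w‖ ≠ 0 := norm_ne_zero_iff.2 hw
      have h2 := h ⟨‖w‖⁻¹ • w, by simp [norm_smul, hw0]⟩
      have h3 := polyFun_smul_arg hp ‖w‖ (‖w‖⁻¹ • w)
      rwa [h2, mul_zero, smul_smul, mul_inv_cancel₀ hw0, one_smul] at h3
  refine MvPolynomial.funext fun v => ?_
  simpa [polyFun] using h1 (WithLp.toLp 2 v)

instance instIsProbabilityMeasureUniformSphere [NeZero d] :
    IsProbabilityMeasure (uniformSphere d) := by
  refine ⟨?_⟩
  rw [uniformSphere, Measure.smul_apply, smul_eq_mul]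
  exact ENNReal.inv_mul_cancel
    (Measure.measure_univ_ne_zero.2 (Measure.toSphere_ne_zero _)) (measure_ne_top _ _)

instance instIsOpenPosMeasureUniformSphere : (uniformSphere d).IsOpenPosMeasure := by
  refine ⟨fun U hU hne => ?_⟩
  rw [uniformSphere, Measure.smul_apply, smul_eq_mul]
  exact mul_ne_zero (ENNReal.inv_ne_zero.2 (measure_ne_top _ _)) (hU.measure_ne_zero _ hne)

lemma sphDim_eq_finrank_harmonicPoly [NeZero d] (k : ℕ) :
    sphDim d k = Module.finrank ℝ (harmonicPoly d k) := by
  rw [sphDim, sphHarmonics, ← LinearMap.range_domRestrict]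
  refine LinearMap.finrank_range_of_inj ?_
  rw [injective_iff_map_eq_zero]
  rintro ⟨p, hp⟩ h
  have h1 : ContinuousMap.toLp 2 (uniformSphere d) ℝ (restrictToSphere d p) = 0 := h
  have h2 : restrictToSphere d p = 0 :=
    ContinuousMap.toLp_injective (𝕜 := ℝ) (p := 2) (uniformSphere d) (by rw [h1, map_zero])
  have h3 := eq_zero_of_polyFun_sphere_eq_zero (mem_harmonicPoly.1 hp).1 fun x => by
    rw [← restrictToSphere_apply, h2]; rfl
  exact Subtype.ext h3

lemma one_mem_harmonicPoly (d : ℕ) : (1 : MvPolynomial (Fin d) ℝ) ∈ harmonicPoly d 0 :=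
  mem_harmonicPoly.2 ⟨MvPolynomial.isHomogeneous_one _ _, by simp [polyLaplacian_apply]⟩

lemma one_le_sphDim_zero [NeZero d] : 1 ≤ sphDim d 0 := by
  rw [sphDim_eq_finrank_harmonicPoly, Nat.one_le_iff_ne_zero, Ne, Submodule.finrank_eq_zero]
  intro h
  have := one_mem_harmonicPoly d
  rw [h, Submodule.mem_bot] at this
  exact one_ne_zero this

/-- The Funk-Hecke multipliers of the absolute value decay at most like `k⁻² / √N_k`, up to a factor
polynomial in the dimension. -/
theorem exists_le_sqrt_sphDim_mul_absMult :
    ∃ c : ℝ, 0 < c ∧ ∀ d : ℕ, 2 ≤ d → ∀ k : ℕ, Even k →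
      c ≤ √(sphDim d k : ℝ) * |absMult d k| * ((d : ℝ) * ((max k 1 : ℕ) : ℝ) ^ 2) := by
  have hc := absFourierConst_pos
  have hz := absFourierConstZero_pos
  have hκ := momentConst_pos
  refine ⟨min (absFourierConstZero / absFourierConst) (2 / absFourierConst * √(momentConst / 2)),
    by positivity, fun d hd k hk => ?_⟩
  obtain ⟨e, rfl⟩ : ∃ e, d = e + 2 := ⟨d - 2, by omega⟩
  rcases Nat.eq_zero_or_pos k with rfl | hkpos
  · refine (min_le_left _ _).trans ?_
    have h1 : (1 : ℝ) ≤ √(sphDim (e + 2) 0 : ℝ) := by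
      rw [Real.one_le_sqrt]; exact_mod_cast one_le_sphDim_zero
    have h2 : absMult (e + 2) 0 = absFourierConstZero / absFourierConst / momentRatio (e + 1) := by
      simp only [absMult, gaussAbsMult, momentRatio, zero_add]
      rw [show e + 2 - 1 = e + 1 by omega]
      have := (radialMoment_pos (e + 1)).ne'
      have := (radialMoment_pos (e + 1 + 1)).ne'
      field_simp
    have h3 := momentRatio_pos (e + 1)
    have h4 : momentRatio (e + 1) ≤ e + 2 := by
      have := momentRatio_le (e + 1)
      push_cast at this
      linarith
    rw [h2, abs_of_pos (by positivity)]
    calc absFourierConstZero / absFourierConst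
        = 1 * (absFourierConstZero / absFourierConst / (e + 2)) * ((e + 2) * 1) := by field_simp
      _ ≤ √(sphDim (e + 2) 0 : ℝ) * (absFourierConstZero / absFourierConst / momentRatio (e + 1)) *
          (((e + 2 : ℕ) : ℝ) * ((max 0 1 : ℕ) : ℝ) ^ 2) := by
        have hm : ((max 0 1 : ℕ) : ℝ) ^ 2 = 1 := by norm_num
        rw [hm, show ((e + 2 : ℕ) : ℝ) = (e : ℝ) + 2 by push_cast; ring]
        gcongr
  · refine (min_le_right _ _).trans ?_
    obtain ⟨j, rfl⟩ : ∃ j, k = j + 2 := by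
      obtain ⟨r, rfl⟩ := hk
      exact ⟨2 * r - 2, by omega⟩
    set A := radialMoment (e + 1) * radialMoment j / radialMoment (e + j + 4) with hA
    have hA0 : 0 < A := by
      have := radialMoment_pos (e + 1)
      have := radialMoment_pos j
      have := radialMoment_pos (e + j + 4)
      positivity
    have h1 : |absMult (e + 2) (j + 2)| = 2 / absFourierConst * A := by
      have h2 : absMult (e + 2) (j + 2) = (-1) ^ ((j + 2) / 2 + 1) * (2 / absFourierConst * A) := by
        change (-1) ^ ((j + 1 + 1) / 2 + 1) * (2 * radialMoment (j + 1 + 1 - 2)) *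
          radialMoment (e + 2 - 1) /
          (absFourierConst * radialMoment (e + 2 - 1 + (j + 1 + 1 + 1))) = _
        rw [show j + 1 + 1 - 2 = j by omega, show e + 2 - 1 = e + 1 by omega,
          show e + 1 + (j + 1 + 1 + 1) = e + j + 4 by omega, hA]
        have := (radialMoment_pos (e + j + 4)).ne'
        field_simp
      rw [h2, abs_mul, abs_pow, abs_neg, abs_one, one_pow, one_mul, abs_of_pos (by positivity)]
    have hdim : ((e + j + 2).choose (j + 2) : ℝ) ≤ sphDim (e + 2) (j + 2) := by
      rw [sphDim_eq_finrank_harmonicPoly]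
      exact_mod_cast choose_le_finrank_harmonicPoly e j
    have hmax : ((max (j + 2) 1 : ℕ) : ℝ) = (j : ℝ) + 2 := by
      rw [max_eq_left (by omega)]; push_cast; ring
    have hch : ((e + j + 2).choose (j + 2) : ℝ) * ((j + 2).factorial * e.factorial) =
        (e + j + 2).factorial := by
      have := Nat.add_choose_mul_factorial_mul_factorial e (j + 2)
      rw [show e + (j + 2) = e + j + 2 by omega] at this
      rw [mul_comm ((j + 2).factorial : ℝ), ← mul_assoc]
      exact_mod_cast this
    have hsq : momentConst / 2 ≤ sphDim (e + 2) (j + 2) * A ^ 2 *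
        (((e : ℝ) + 2) * ((j : ℝ) + 2) ^ 2) ^ 2 := by
      have h4 := le_radialMoment_ratio e j
      have f0 : (0 : ℝ) < e.factorial := by positivity
      have f1 : (0 : ℝ) < (j + 2).factorial := by positivity
      have f2 : (0 : ℝ) < j.factorial := by positivity
      have f3 : (0 : ℝ) < (e + j + 2).factorial := by positivity
      have hch' : ((e + j + 2).choose (j + 2) : ℝ) =
          (e + j + 2).factorial / ((j + 2).factorial * e.factorial) := by
        rw [eq_div_iff (by positivity), hch]
      have e1 : ((e + 1).factorial : ℝ) = (e + 1) * e.factorial := by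
        rw [Nat.factorial_succ]; push_cast; ring
      have e2 : ((j + 2).factorial : ℝ) = (j + 2) * ((j + 1) * j.factorial) := by
        rw [Nat.factorial_succ, Nat.factorial_succ]; push_cast; ring
      have e3 : ((e + j + 4).factorial : ℝ) =
          (e + j + 4) * ((e + j + 3) * (e + j + 2).factorial) := by
        rw [Nat.factorial_succ, Nat.factorial_succ]; push_cast; ring
      calc momentConst / 2
          ≤ (momentConst * ((e + 1) / ((e + 2) * ((e + j + 4) * (e + j + 3)) *
              ((j + 2) * (j + 1))))) * (((e : ℝ) + 2) * ((j : ℝ) + 2) ^ 2) ^ 2 := by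
            rw [div_eq_mul_one_div, mul_assoc]
            refine mul_le_mul_of_nonneg_left ?_ hκ.le
            rw [div_mul_eq_mul_div, div_le_div_iff₀ (by norm_num) (by positivity)]
            have he : (0 : ℝ) ≤ e := e.cast_nonneg
            have hj : (0 : ℝ) ≤ j := j.cast_nonneg
            have b1 : (e + j + 4 : ℝ) ≤ (e + 2) * (j + 2) := by nlinarith
            have b2 : (e + j + 3 : ℝ) ≤ (e + 2) * (j + 2) := by nlinarith
            have b3 : ((j : ℝ) + 2) * (j + 1) ≤ (j + 2) * (j + 2) := by nlinarith
            calc 1 * (((e : ℝ) + 2) * ((e + j + 4) * (e + j + 3)) * ((j + 2) * (j + 1)))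
                ≤ 1 * (((e : ℝ) + 2) * (((e + 2) * (j + 2)) * ((e + 2) * (j + 2))) *
                  ((j + 2) * (j + 2))) := by gcongr
              _ = ((e : ℝ) + 2) * (((e : ℝ) + 2) * ((j : ℝ) + 2) ^ 2) ^ 2 := by ring
              _ ≤ (2 * ((e : ℝ) + 1)) * (((e : ℝ) + 2) * ((j : ℝ) + 2) ^ 2) ^ 2 := by
                  gcongr; linarith
              _ = _ := by ring
        _ = ((e + j + 2).choose (j + 2) : ℝ) * (momentConst * (e + 1).factorial * j.factorial /
              ((e + 2) * (e + j + 4).factorial)) * (((e : ℝ) + 2) * ((j : ℝ) + 2) ^ 2) ^ 2 := by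
            congr 1
            rw [hch', e1, e2, e3]
            field_simp
        _ ≤ _ := by gcongr
    rw [h1, hmax]
    push_cast
    have h5 : √(momentConst / 2) ≤ √(sphDim (e + 2) (j + 2) : ℝ) * A *
        (((e : ℝ) + 2) * ((j : ℝ) + 2) ^ 2) := by
      refine Real.sqrt_le_iff.2 ⟨by positivity, hsq.trans_eq ?_⟩
      rw [mul_pow (√(sphDim (e + 2) (j + 2) : ℝ) * A), mul_pow (√_) A, Real.sq_sqrt (by positivity)]
    calc 2 / absFourierConst * √(momentConst / 2)
        ≤ 2 / absFourierConst * (√(sphDim (e + 2) (j + 2) : ℝ) * A *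
        (((e : ℝ) + 2) * ((j : ℝ) + 2) ^ 2)) := by gcongr
      _ = _ := by ring

end Restriction

/-! ### Completeness and orthogonality of spherical harmonics -/

section Completeness

variable {d : ℕ}

/-- The polynomial `∑ᵢ xᵢ²`. -/
def normSqPoly (d : ℕ) : MvPolynomial (Fin d) ℝ := ∑ i, MvPolynomial.X i ^ 2

lemma polyFun_normSqPoly (w : EuclideanSpace ℝ (Fin d)) : polyFun (normSqPoly d) w = ‖w‖ ^ 2 := by
  simp [normSqPoly, polyFun, EuclideanSpace.norm_sq_eq]

lemma isHomogeneous_normSqPoly : (normSqPoly d).IsHomogeneous 2 :=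
  MvPolynomial.IsHomogeneous.sum _ _ _ fun i _ => MvPolynomial.isHomogeneous_X_pow i 2

lemma eq_zero_of_polyLaplacian_normSqPoly_mul [NeZero d] {m : ℕ} {q : MvPolynomial (Fin d) ℝ}
    (hq : q.IsHomogeneous m) (h : polyLaplacian d (normSqPoly d * q) = 0) : q = 0 := by
  have hp : normSqPoly d * q ∈ harmonicPoly d (m + 2) :=
    mem_harmonicPoly.2 ⟨by rw [add_comm]; exact isHomogeneous_normSqPoly.mul hq, h⟩
  have h0 := gaussInt_mul_harmonic (by omega) hq hp
  rw [gaussInt_apply, integral_eq_zero_iff_of_nonneg _ (integrable_gauss_polyFun _)] at h0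
  · have hc : Continuous fun w => gaussDensity w • polyFun (q * (normSqPoly d * q)) w :=
      continuous_gaussDensity.smul (continuous_polyFun _)
    have h1 := (Continuous.ae_eq_iff_eq volume hc continuous_zero).1 h0
    refine eq_zero_of_polyFun_sphere_eq_zero hq fun x => ?_
    have h2 := congrFun h1 x
    simpa [polyFun_normSqPoly, (gaussDensity_pos _).ne'] using h2
  · intro w
    simp only [polyFun_mul, polyFun_normSqPoly, smul_eq_mul, Pi.zero_apply]
    have := gaussDensity_pos w
    have h3 : polyFun q w * (‖w‖ ^ 2 * polyFun q w) = (‖w‖ * polyFun q w) ^ 2 := by ring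
    rw [h3]
    positivity

/-- Every homogeneous polynomial is the sum of a harmonic one and a multiple of `|x|²`. -/
lemma exists_harmonic_add_normSqPoly_mul [NeZero d] {m : ℕ} {p : MvPolynomial (Fin d) ℝ}
    (hp : p.IsHomogeneous (m + 2)) : ∃ q : MvPolynomial (Fin d) ℝ, q.IsHomogeneous m ∧
      p - normSqPoly d * q ∈ harmonicPoly d (m + 2) := by
  have := finiteDimensional_homogeneous d m
  set V := MvPolynomial.homogeneousSubmodule (Fin d) ℝ m
  have hmul {q : MvPolynomial (Fin d) ℝ} (hq : q.IsHomogeneous m) :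
      (normSqPoly d * q).IsHomogeneous (m + 2) := by
    rw [add_comm]; exact isHomogeneous_normSqPoly.mul hq
  let L : V →ₗ[ℝ] V := (polyLaplacian d ∘ₗ LinearMap.mulLeft ℝ (normSqPoly d)).restrict
    fun q hq => isHomogeneous_polyLaplacian (hmul hq)
  have hinj : Function.Injective L := by
    rw [injective_iff_map_eq_zero]
    rintro ⟨q, hq⟩ h
    exact Subtype.ext (eq_zero_of_polyLaplacian_normSqPoly_mul hq (congrArg Subtype.val h))
  obtain ⟨⟨q, hq⟩, h⟩ := (LinearMap.injective_iff_surjective.1 hinj)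
    ⟨polyLaplacian d p, isHomogeneous_polyLaplacian hp⟩
  refine ⟨q, hq, mem_harmonicPoly.2 ⟨hp.sub (hmul hq), ?_⟩⟩
  have h' : polyLaplacian d (normSqPoly d * q) = polyLaplacian d p := congrArg Subtype.val h
  rw [map_sub, h', sub_self]

lemma mem_harmonicPoly_of_lt_two {m : ℕ} (hm : m < 2) {p : MvPolynomial (Fin d) ℝ}
    (hp : p.IsHomogeneous m) : p ∈ harmonicPoly d m := by
  refine mem_harmonicPoly.2 ⟨hp, ?_⟩
  rw [polyLaplacian_apply]
  refine Finset.sum_eq_zero fun i _ => ?_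
  have h1 : (MvPolynomial.pderiv i p).IsHomogeneous 0 := by
    have := hp.pderiv (i := i)
    rwa [show m - 1 = 0 by omega] at this
  rw [← MvPolynomial.totalDegree_zero_iff_isHomogeneous,
    MvPolynomial.totalDegree_eq_zero_iff_eq_C] at h1
  rw [h1, MvPolynomial.pderiv_C]

/-- A linear functional which vanishes on spherical harmonics vanishes on all polynomials restricted
to the sphere. -/
lemma eq_zero_of_forall_harmonic_eq_zero [NeZero d] (L : C(USphere d, ℝ) →ₗ[ℝ] ℝ)
    (hL : ∀ k, ∀ p ∈ harmonicPoly d k, L (restrictToSphere d p) = 0)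
    (p : MvPolynomial (Fin d) ℝ) : L (restrictToSphere d p) = 0 := by
  have hom (m : ℕ) : ∀ p : MvPolynomial (Fin d) ℝ, p.IsHomogeneous m →
      L (restrictToSphere d p) = 0 := by
    induction m using Nat.strong_induction_on with
    | _ m ih =>
      intro p hp
      rcases lt_or_ge m 2 with hm | hm
      · exact hL m p (mem_harmonicPoly_of_lt_two hm hp)
      · obtain ⟨m, rfl⟩ : ∃ j, m = j + 2 := ⟨m - 2, by omega⟩
        obtain ⟨q, hq, h⟩ := exists_harmonic_add_normSqPoly_mul hp
        have h1 : restrictToSphere d (normSqPoly d * q) = restrictToSphere d q := by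
          ext x
          simp [restrictToSphere_apply, polyFun_normSqPoly]
        have h2 := hL _ _ h
        rwa [map_sub, h1, map_sub, ih m (by omega) q hq, sub_zero] at h2
  rw [← MvPolynomial.sum_homogeneousComponent p, map_sum, map_sum]
  exact Finset.sum_eq_zero fun i _ => hom i _ (MvPolynomial.homogeneousComponent_isHomogeneous i p)

lemma aeval_coord_eq_restrictToSphere (p : MvPolynomial (Fin d) ℝ) :
    MvPolynomial.aeval (fun i : Fin d => restrictToSphere d (MvPolynomial.X i)) p =
      restrictToSphere d p := by
  induction p using MvPolynomial.induction_on with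
  | C c => ext x; simp [restrictToSphere_apply]
  | add p q hp hq => simp [hp, hq]
  | mul_X p i hp => ext x; simp [hp, restrictToSphere_apply]

lemma dense_range_restrictToSphere :
    DenseRange (restrictToSphere d : MvPolynomial (Fin d) ℝ → C(USphere d, ℝ)) := by
  set A := (MvPolynomial.aeval (R := ℝ)
    (fun i : Fin d => restrictToSphere d (MvPolynomial.X i))).range with hA
  have hsep : A.SeparatesPoints := by
    intro x y hxy
    obtain ⟨i, hi⟩ : ∃ i, x.1 i ≠ y.1 i := by
      by_contra! h
      exact hxy (Subtype.ext (PiLp.ext h))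
    refine ⟨_, ⟨restrictToSphere d (MvPolynomial.X i), ⟨MvPolynomial.X i, by simp⟩, rfl⟩, ?_⟩
    simpa [restrictToSphere_apply] using hi
  have h := ContinuousMap.subalgebra_topologicalClosure_eq_top_of_separatesPoints A hsep
  have hr : Set.range (restrictToSphere d : MvPolynomial (Fin d) ℝ → C(USphere d, ℝ)) = A := by
    ext g
    simp only [Set.mem_range, hA, SetLike.mem_coe, AlgHom.mem_range,
      aeval_coord_eq_restrictToSphere]
  rw [DenseRange, hr, dense_iff_closure_eq, ← Subalgebra.topologicalClosure_coe, h]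
  rfl

/-- A continuous function on the sphere orthogonal to all spherical harmonics vanishes. -/
theorem eq_zero_of_inner_harmonic_eq_zero [NeZero d] (u : C(USphere d, ℝ))
    (hu : ∀ k, ∀ p ∈ harmonicPoly d k,
      ⟪ContinuousMap.toLp 2 (uniformSphere d) ℝ u,
        ContinuousMap.toLp 2 (uniformSphere d) ℝ (restrictToSphere d p)⟫ = 0) : u = 0 := by
  let L : C(USphere d, ℝ) →L[ℝ] ℝ := (innerSL ℝ (ContinuousMap.toLp 2 (uniformSphere d) ℝ u)) ∘L
    (ContinuousMap.toLp 2 (uniformSphere d) ℝ)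
  have h1 : ∀ p, L (restrictToSphere d p) = 0 :=
    eq_zero_of_forall_harmonic_eq_zero L.toLinearMap hu
  have h2 : (L : C(USphere d, ℝ) → ℝ) = fun _ => 0 :=
    dense_range_restrictToSphere.equalizer L.continuous continuous_const (funext h1)
  have h3 : ⟪ContinuousMap.toLp 2 (uniformSphere d) ℝ u,
    ContinuousMap.toLp 2 (uniformSphere d) ℝ u⟫ = 0 := congrFun h2 u
  refine ContinuousMap.toLp_injective (𝕜 := ℝ) (p := 2) (uniformSphere d) ?_
  rw [inner_self_eq_zero.1 h3, map_zero]

lemma inner_toLp_uniformSphere (u v : C(USphere d, ℝ)) :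
    ⟪ContinuousMap.toLp 2 (uniformSphere d) ℝ u, ContinuousMap.toLp 2 (uniformSphere d) ℝ v⟫ =
      ∫ x, u x * v x ∂(uniformSphere d) := by
  rw [ContinuousMap.inner_toLp]
  refine integral_congr_ae (.of_forall fun x => ?_)
  simp [mul_comm]

/-- Spherical harmonics of different degrees are orthogonal. -/
theorem inner_harmonic_eq_zero [NeZero d] {j k : ℕ} (hjk : j ≠ k) {p q : MvPolynomial (Fin d) ℝ}
    (hp : p ∈ harmonicPoly d j) (hq : q ∈ harmonicPoly d k) :
    ⟪ContinuousMap.toLp 2 (uniformSphere d) ℝ (restrictToSphere d p),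
      ContinuousMap.toLp 2 (uniformSphere d) ℝ (restrictToSphere d q)⟫ = 0 := by
  have h1 : gaussInt d (p * q) = 0 := by
    rcases lt_or_gt_of_ne hjk with h | h
    · exact gaussInt_mul_harmonic h (mem_harmonicPoly.1 hp).1 hq
    · rw [mul_comm]; exact gaussInt_mul_harmonic h (mem_harmonicPoly.1 hq).1 hp
  have h2 := radialMoment_mul_integral_gauss (NeZero.ne d) (m := j + k) (F := polyFun (p * q))
    (fun r _ w => polyFun_smul_arg ((mem_harmonicPoly.1 hp).1.mul (mem_harmonicPoly.1 hq).1) r w)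
  rw [← gaussInt_apply, h1, mul_zero] at h2
  have h3 := mul_pos (radialMoment_pos (d - 1 + (j + k))) (gaussInt_one_pos (NeZero.ne d))
  rw [inner_toLp_uniformSphere]
  simpa [h3.ne', restrictToSphere_apply, (radialMoment_pos _).ne',
    (gaussInt_one_pos (NeZero.ne d)).ne'] using h2

open scoped Pointwise in
/-- The antipodal map preserves the uniform measure on the sphere. -/
lemma measurePreserving_neg_uniformSphere :
    MeasurePreserving (fun x : USphere d => -x) (uniformSphere d) (uniformSphere d) := by
  have hm : Measurable fun x : USphere d => -x := continuous_neg.measurable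
  refine ⟨hm, ?_⟩
  rw [uniformSphere, Measure.map_smul]
  congr 1
  ext s hs
  rw [Measure.map_apply hm hs, Measure.toSphere_apply' _ (hm hs), Measure.toSphere_apply' _ hs]
  congr 1
  rw [← Measure.measure_preimage_neg (μ := (volume : Measure (EuclideanSpace ℝ (Fin d))))
    (Set.Ioo (0 : ℝ) 1 • (Subtype.val '' s))]
  congr 1
  ext w
  simp only [Set.mem_smul, Set.mem_image, Set.mem_preimage]
  constructor
  · rintro ⟨r, hr, _, ⟨x, hx, rfl⟩, rfl⟩
    exact ⟨r, hr, _, ⟨-x, hx, rfl⟩, by simp⟩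
  · rintro ⟨r, hr, _, ⟨x, hx, rfl⟩, h⟩
    exact ⟨r, hr, _, ⟨-x, by simpa using hx, rfl⟩, by simp [h]⟩

lemma polyFun_neg_arg {k : ℕ} {p : MvPolynomial (Fin d) ℝ} (hp : p.IsHomogeneous k)
    (w : EuclideanSpace ℝ (Fin d)) : polyFun p (-w) = (-1) ^ k * polyFun p w := by
  rw [← neg_one_smul ℝ w, polyFun_smul_arg hp]

lemma sphComponent_eq_zero_of_odd {f : C(USphere d, ℝ)} (hf : ∀ x, f (-x) = f x) {k : ℕ}
    (hk : Odd k) : sphComponent k f = 0 := by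
  rw [sphComponent, Submodule.starProjection_apply_eq_zero_iff, Submodule.mem_orthogonal']
  rintro _ ⟨p, hp, rfl⟩
  change ⟪ContinuousMap.toLp 2 (uniformSphere d) ℝ f,
    ContinuousMap.toLp 2 (uniformSphere d) ℝ (restrictToSphere d p)⟫ = 0
  rw [inner_toLp_uniformSphere]
  have h := (measurePreserving_neg_uniformSphere (d := d)).integral_comp
    (Homeomorph.neg (USphere d)).measurableEmbedding (fun x => f x * restrictToSphere d p x)
  simp only [hf, restrictToSphere_apply, coe_neg_sphere,
    polyFun_neg_arg (mem_harmonicPoly.1 hp).1, hk.neg_one_pow, neg_mul, one_mul, mul_neg] at h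
  rw [integral_neg] at h
  simp only [restrictToSphere_apply]
  linarith

end Completeness

/-! ### Representation of a function as the cosine transform of an even density -/

section Density

variable {d : ℕ}

lemma abs_inner_sphere_le_one (x w : USphere d) :
    |⟪(x : EuclideanSpace ℝ (Fin d)), (w : EuclideanSpace ℝ (Fin d))⟫| ≤ 1 := by
  have h := abs_real_inner_le_norm (x : EuclideanSpace ℝ (Fin d)) w
  rwa [norm_eq_of_mem_sphere, norm_eq_of_mem_sphere, one_mul] at h

lemma integrable_continuousMap (u : C(USphere d, ℝ)) : Integrable u (uniformSphere d) :=
  u.continuous.integrable_of_hasCompactSupport (HasCompactSupport.of_compactSpace _)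

lemma exists_harmonicPoly_eq_sphComponent (k : ℕ) (f : C(USphere d, ℝ)) :
    ∃ p ∈ harmonicPoly d k,
      ContinuousMap.toLp 2 (uniformSphere d) ℝ (restrictToSphere d p) = sphComponent k f := by
  have h : sphComponent k f ∈ sphHarmonics d k := Submodule.starProjection_apply_mem _ _
  obtain ⟨p, hp, h⟩ := h
  exact ⟨p, hp, h⟩

lemma eq_of_hasSum_harmonic [NeZero d] {f F : C(USphere d, ℝ)} {p : ℕ → MvPolynomial (Fin d) ℝ}
    (hp : ∀ k, p k ∈ harmonicPoly d k)
    (hpf : ∀ k, ContinuousMap.toLp 2 (uniformSphere d) ℝ (restrictToSphere d (p k)) =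
      sphComponent k f)
    (hF : HasSum (fun k => restrictToSphere d (p k)) F) : F = f := by
  rw [← sub_eq_zero]
  refine eq_zero_of_inner_harmonic_eq_zero _ fun j q hq => ?_
  rw [map_sub, inner_sub_left, sub_eq_zero]
  set y := ContinuousMap.toLp 2 (uniformSphere d) ℝ (restrictToSphere d q)
  have h1 : HasSum (fun k => ⟪y,
      ContinuousMap.toLp 2 (uniformSphere d) ℝ (restrictToSphere d (p k))⟫)
      ⟪y, ContinuousMap.toLp 2 (uniformSphere d) ℝ F⟫ :=
    (hF.mapL (ContinuousMap.toLp 2 (uniformSphere d) ℝ)).mapL (innerSL ℝ y)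
  have h2 := h1.unique (hasSum_single j fun k hk => inner_harmonic_eq_zero hk.symm hq (hp k))
  rw [real_inner_comm, h2, hpf, real_inner_comm]
  have h3 := Submodule.starProjection_inner_eq_zero (K := sphHarmonics d j)
    (ContinuousMap.toLp 2 (uniformSphere d) ℝ f) y ⟨q, hq, rfl⟩
  rw [inner_sub_left, sub_eq_zero] at h3
  exact h3.symm

/-- If `f` is the sum of `f_k` and `∑ ‖f_k‖₁ / |λ_k|` converges, then `f` is the cosine transform of
an even density with `L¹` norm at most this sum. -/
theorem exists_density_of_summable [NeZero d] {f : C(USphere d, ℝ)} (hf : ∀ x, f (-x) = f x)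
    (hmult : ∀ k, Even k → absMult d k ≠ 0)
    (hsum : Summable fun k => |absMult d k|⁻¹ * componentL1 k f) :
    ∃ g : USphere d → ℝ, Measurable g ∧ Integrable g (uniformSphere d) ∧ (∀ x, g (-x) = g x) ∧
      ∫ w, |g w| ∂(uniformSphere d) ≤ ∑' k, |absMult d k|⁻¹ * componentL1 k f ∧
      ∀ x : USphere d, f x = ∫ w : USphere d,
        |⟪(w : EuclideanSpace ℝ (Fin d)), (x : EuclideanSpace ℝ (Fin d))⟫| * g w
          ∂(uniformSphere d) := by
  choose p hp hpf using fun k => exists_harmonicPoly_eq_sphComponent k f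
  set S := uniformSphere d
  have hodd (k : ℕ) (hk : ¬ Even k) : restrictToSphere d (p k) = 0 := by
    refine ContinuousMap.toLp_injective (𝕜 := ℝ) (p := 2) S ?_
    rw [hpf, sphComponent_eq_zero_of_odd hf (Nat.not_even_iff_odd.1 hk), map_zero]
  set φ : ℕ → C(USphere d, ℝ) := fun k => (absMult d k)⁻¹ • restrictToSphere d (p k) with hφ
  have hφint (k : ℕ) : Integrable (φ k) S := integrable_continuousMap _
  have hL1 (k : ℕ) : ∫ w, ‖φ k w‖ ∂S = |absMult d k|⁻¹ * componentL1 k f := by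
    rw [componentL1, ← hpf k, ← integral_const_mul]
    refine integral_congr_ae ?_
    filter_upwards [ContinuousMap.coeFn_toLp (p := 2) (𝕜 := ℝ) S (restrictToSphere d (p k))]
      with w hw
    rw [hw]
    simp [hφ]
  have hsum' : Summable fun k => ∫ w, ‖φ k w‖ ∂S := by simpa only [hL1] using hsum
  set g : USphere d → ℝ := fun w => ∑' k, φ k w with hg
  have hgm : Measurable g := Measurable.tsum fun k => (φ k).continuous.measurable
  have hlin : ∫⁻ w, ‖g w‖ₑ ∂S ≤ ENNReal.ofReal (∑' k, |absMult d k|⁻¹ * componentL1 k f) := by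
    calc ∫⁻ w, ‖g w‖ₑ ∂S ≤ ∫⁻ w, ∑' k, ‖φ k w‖ₑ ∂S :=
          lintegral_mono fun w => enorm_tsum_le_tsum_enorm
      _ = ∑' k, ∫⁻ w, ‖φ k w‖ₑ ∂S := lintegral_tsum fun k => (hφint k).1.enorm
      _ = ∑' k, ENNReal.ofReal (∫ w, ‖φ k w‖ ∂S) := by
          simp only [ofReal_integral_norm_eq_lintegral_enorm (hφint _)]
      _ = ENNReal.ofReal (∑' k, ∫ w, ‖φ k w‖ ∂S) :=
          (ENNReal.ofReal_tsum_of_nonneg (fun k => integral_nonneg fun w => norm_nonneg _)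
            hsum').symm
      _ = _ := by simp only [hL1]
  have hgint : Integrable g S :=
    ⟨hgm.aestronglyMeasurable, lt_of_le_of_lt hlin ENNReal.ofReal_lt_top⟩
  have hrep (x : USphere d) : HasSum (fun k => polyFun (p k) x) (∫ w : USphere d,
      |⟪(w : EuclideanSpace ℝ (Fin d)), (x : EuclideanSpace ℝ (Fin d))⟫| * g w ∂S) := by
    have hψ : Continuous fun w : USphere d =>
        |⟪(w : EuclideanSpace ℝ (Fin d)), (x : EuclideanSpace ℝ (Fin d))⟫| := by fun_prop
    have hbound (k : ℕ) (w : USphere d) :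
        ‖|⟪(w : EuclideanSpace ℝ (Fin d)), (x : EuclideanSpace ℝ (Fin d))⟫| * φ k w‖ ≤ ‖φ k w‖ := by
      rw [norm_mul, Real.norm_eq_abs, abs_abs]
      exact mul_le_of_le_one_left (norm_nonneg _) (abs_inner_sphere_le_one w x)
    have hi (k : ℕ) : Integrable (fun w : USphere d =>
        |⟪(w : EuclideanSpace ℝ (Fin d)), (x : EuclideanSpace ℝ (Fin d))⟫| * φ k w) S :=
      (hφint k).mono (hψ.mul (φ k).continuous).aestronglyMeasurable (.of_forall (hbound k))
    have h := hasSum_integral_of_summable_integral_norm hi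
      (Summable.of_nonneg_of_le (fun k => integral_nonneg fun w => norm_nonneg _)
        (fun k => integral_mono (hi k).norm (hφint k).norm (hbound k)) hsum')
    simp only [tsum_mul_left] at h
    have key : (fun k => polyFun (p k) x) = fun k => ∫ w : USphere d,
        |⟪(w : EuclideanSpace ℝ (Fin d)), (x : EuclideanSpace ℝ (Fin d))⟫| * φ k w ∂S := by
      funext k
      symm
      by_cases hk : Even k
      · have h1 := integral_abs_mul_harmonic (NeZero.ne d) (x : EuclideanSpace ℝ (Fin d))
          (norm_eq_of_mem_sphere x) hk (hp k)
        have h2 : ∀ w : USphere d,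
            |⟪(w : EuclideanSpace ℝ (Fin d)), (x : EuclideanSpace ℝ (Fin d))⟫| * φ k w =
            (absMult d k)⁻¹ * (|⟪(x : EuclideanSpace ℝ (Fin d)), (w : EuclideanSpace ℝ (Fin d))⟫| *
              polyFun (p k) w) := fun w => by
          rw [real_inner_comm]
          simp only [hφ, ContinuousMap.smul_apply, smul_eq_mul, restrictToSphere_apply]
          ring
        simp only [h2]
        rw [integral_const_mul, h1, inv_mul_cancel_left₀ (hmult k hk)]
      · have h1 : polyFun (p k) x = 0 := by rw [← restrictToSphere_apply, hodd k hk]; rfl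
        simp [hφ, hodd k hk, h1]
    rwa [key]
  have hsup (k : ℕ) : ‖restrictToSphere d (p k)‖ ≤ ∫ w, ‖φ k w‖ ∂S := by
    rw [ContinuousMap.norm_le _ (integral_nonneg fun w => norm_nonneg _)]
    intro x
    by_cases hk : Even k
    · have h1 := integral_abs_mul_harmonic (NeZero.ne d) (x : EuclideanSpace ℝ (Fin d))
        (norm_eq_of_mem_sphere x) hk (hp k)
      have h2 : polyFun (p k) x = ∫ w : USphere d,
          |⟪(x : EuclideanSpace ℝ (Fin d)), (w : EuclideanSpace ℝ (Fin d))⟫| * φ k w ∂S := by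
        rw [← inv_mul_cancel_left₀ (hmult k hk) (polyFun (p k) x), ← h1, ← integral_const_mul]
        refine integral_congr_ae (.of_forall fun w => ?_)
        simp only [hφ, ContinuousMap.smul_apply, smul_eq_mul, restrictToSphere_apply]
        ring
      rw [restrictToSphere_apply, h2]
      refine (norm_integral_le_integral_norm _).trans ?_
      refine integral_mono_of_nonneg (.of_forall fun w => norm_nonneg _) (hφint k).norm
        (.of_forall fun w => ?_)
      simp only [norm_mul, Real.norm_eq_abs, abs_abs]
      exact mul_le_of_le_one_left (abs_nonneg _) (abs_inner_sphere_le_one x w)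
    · rw [hodd k hk]
      simpa using integral_nonneg fun w => abs_nonneg _
  have hsummable : Summable fun k => restrictToSphere d (p k) :=
    Summable.of_norm_bounded hsum' hsup
  set F : C(USphere d, ℝ) := ∑' k, restrictToSphere d (p k) with hF
  have hFsum : HasSum (fun k => restrictToSphere d (p k)) F := hsummable.hasSum
  have hFx (x : USphere d) : F x = ∫ w : USphere d,
      |⟪(w : EuclideanSpace ℝ (Fin d)), (x : EuclideanSpace ℝ (Fin d))⟫| * g w ∂S := by
    have h1 : HasSum (fun k => polyFun (p k) x) (F x) :=
      hFsum.mapL (ContinuousMap.evalCLM ℝ x)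
    exact h1.unique (hrep x)
  have hFf : F = f := eq_of_hasSum_harmonic hp hpf hFsum
  refine ⟨g, hgm, hgint, fun x => ?_, ?_, fun x => by rw [← hFf, hFx]⟩
  · simp only [hg]
    refine tsum_congr fun k => ?_
    by_cases hk : Even k
    · simp [hφ, restrictToSphere_apply, polyFun_neg_arg (mem_harmonicPoly.1 (hp k)).1,
        hk.neg_one_pow]
    · simp [hφ, hodd k hk]
  · have h1 : ENNReal.ofReal (∫ w, ‖g w‖ ∂S) ≤ _ :=
      (ofReal_integral_norm_eq_lintegral_enorm hgint).trans_le hlin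
    refine (ENNReal.ofReal_le_ofReal_iff (tsum_nonneg fun k => ?_)).1 h1
    rw [← hL1]
    exact integral_nonneg fun w => norm_nonneg _

end Density

/-! ### Signed measures with a density -/

section SignedDensity

variable {d : ℕ}

lemma integral_withDensityᵥ {X : Type*} [MeasurableSpace X] {μ : Measure X} {g : X → ℝ}
    (hgm : Measurable g) (hg : Integrable g μ) {φ : X → ℝ} (hφ : Measurable φ) {C : ℝ}
    (hC : ∀ x, |φ x| ≤ C) :
    ∫ᵛ x, φ x ∂•(μ.withDensityᵥ g) = ∫ x, φ x * g x ∂μ := by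
  have i1 := isFiniteMeasure_withDensity_ofReal hg.2
  have i2 := isFiniteMeasure_withDensity_ofReal hg.neg.2
  have hflip : (ContinuousLinearMap.lsmul ℝ ℝ : ℝ →L[ℝ] ℝ →L[ℝ] ℝ) =
      (ContinuousLinearMap.lsmul ℝ ℝ : ℝ →L[ℝ] ℝ →L[ℝ] ℝ).flip := by
    ext; simp
  have hb (ν : Measure X) [IsFiniteMeasure ν] : Integrable φ ν :=
    Integrable.of_bound hφ.aestronglyMeasurable C (.of_forall hC)
  have hv (ν : Measure X) [IsFiniteMeasure ν] : ν.toSignedMeasure.Integrable φ := by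
    rw [VectorMeasure.Integrable, Measure.variation_toSignedMeasure]
    exact hb ν
  rw [withDensityᵥ_eq_withDensity_pos_part_sub_withDensity_neg_part hg,
    VectorMeasure.integral_sub_vectorMeasure (hv _) (hv _), hflip,
    VectorMeasure.integral_toSignedMeasure, VectorMeasure.integral_toSignedMeasure]
  have hw (h : X → ℝ) (hm : Measurable h) : ∫ x, φ x ∂(μ.withDensity fun x => ENNReal.ofReal (h x)) =
      ∫ x, max (h x) 0 * φ x ∂μ := by
    rw [integral_withDensity_eq_integral_toReal_smul hm.ennreal_ofReal
      (.of_forall fun x => ENNReal.ofReal_lt_top)]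
    refine integral_congr_ae (.of_forall fun x => ?_)
    simp [ENNReal.toReal_ofReal']
  have hint (h : X → ℝ) (hh : Integrable h μ) : Integrable (fun x => max (h x) 0 * φ x) μ :=
    hh.pos_part.mul_bdd hφ.aestronglyMeasurable (.of_forall hC)
  have := hw (fun x => - g x) hgm.neg
  rw [hw g hgm, this, ← integral_sub (hint g hg) (hint (fun x => -g x) hg.neg)]
  refine integral_congr_ae (.of_forall fun x => ?_)
  simp only
  rcases le_total 0 (g x) with h | h
  · rw [max_eq_left h, max_eq_right (by linarith)]; ring
  · rw [max_eq_right h, max_eq_left (by linarith)]; ring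

lemma isEvenMeasure_withDensityᵥ {g : USphere d → ℝ} (hg : Integrable g (uniformSphere d))
    (heven : ∀ x, g (-x) = g x) : IsEvenMeasure ((uniformSphere d).withDensityᵥ g) := by
  have hm : Measurable fun x : USphere d => -x := continuous_neg.measurable
  refine VectorMeasure.ext fun s hs => ?_
  rw [VectorMeasure.map_apply _ hm hs, withDensityᵥ_apply hg hs, withDensityᵥ_apply hg (hm hs)]
  have h := (measurePreserving_neg_uniformSphere (d := d)).setIntegral_preimage_emb
    (Homeomorph.neg (USphere d)).measurableEmbedding g s
  simpa only [heven] using h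

/-- A function which is the cosine transform of an even density has `γ₁` norm at most the `L¹` norm
of the density. -/
theorem gammaOne_le_of_density {h g : USphere d → ℝ} (hgm : Measurable g)
    (hg : Integrable g (uniformSphere d)) (heven : ∀ x, g (-x) = g x)
    (hh : ∀ x : USphere d, h x = ∫ w : USphere d,
        |⟪(w : EuclideanSpace ℝ (Fin d)), (x : EuclideanSpace ℝ (Fin d))⟫| * g w
          ∂(uniformSphere d)) :
    gammaOne h ≤ ENNReal.ofReal (∫ w, |g w| ∂(uniformSphere d)) := by
  have h1 : h = absPotential ((uniformSphere d).withDensityᵥ g) := by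
    ext x
    rw [hh, absPotential, integral_withDensityᵥ hgm hg (C := 1)]
    · exact Continuous.measurable (by fun_prop)
    · intro w
      rw [abs_abs]
      exact abs_inner_sphere_le_one w x
  have h2 : gammaOne h ≤ SignedMeasure.totalVariation ((uniformSphere d).withDensityᵥ g) Set.univ :=
    iInf_le_of_le _ (iInf_le_of_le (isEvenMeasure_withDensityᵥ hg heven)
      (iInf_le_of_le h1 le_rfl))
  refine h2.trans ?_
  rw [SignedMeasure.totalVariation_eq_variation, Measure.variation_withDensityᵥ hg,
    withDensity_apply _ MeasurableSet.univ, Measure.restrict_univ]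
  exact (ofReal_integral_norm_eq_lintegral_enorm hg).ge

end SignedDensity

/-! ### Approximation by random networks -/

section Sampling

variable {d : ℕ}

/-- The sphere has a net of mesh `d / m` with at most `(2 m + 1) ^ d` points. -/
lemma exists_net_sphere [NeZero d] {m : ℕ} (hm : 0 < m) :
    ∃ T : Finset (USphere d), T.card ≤ (2 * m + 1) ^ d ∧
      ∀ x : USphere d, ∃ y ∈ T,
        ‖(x : EuclideanSpace ℝ (Fin d)) - (y : EuclideanSpace ℝ (Fin d))‖ ≤ d / m := by
  classical
  have hm' : (0 : ℝ) < m := Nat.cast_pos.2 hm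
  have hcoord (x : USphere d) (i : Fin d) : |(x : EuclideanSpace ℝ (Fin d)) i| ≤ 1 := by
    have h := PiLp.norm_apply_le (x : EuclideanSpace ℝ (Fin d)) i
    rwa [norm_eq_of_mem_sphere] at h
  have hcell (x : USphere d) (i : Fin d) :
      ⌊(x : EuclideanSpace ℝ (Fin d)) i * m⌋ ∈ Finset.Icc (-(m : ℤ)) m := by
    have h := abs_le.1 (hcoord x i)
    rw [Finset.mem_Icc]
    constructor
    · rw [Int.le_floor]; push_cast; nlinarith
    · have : ((⌊(x : EuclideanSpace ℝ (Fin d)) i * m⌋ : ℤ) : ℝ) ≤ ((m : ℤ) : ℝ) :=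
        (Int.floor_le _).trans (by push_cast; nlinarith)
      exact_mod_cast this
  set cell : USphere d → (Fin d → Finset.Icc (-(m : ℤ)) m) := fun x i => ⟨_, hcell x i⟩ with hc
  refine ⟨Finset.univ.image (Function.invFun cell), Finset.card_image_le.trans ?_, fun x => ?_⟩
  · rw [Finset.card_univ, Fintype.card_fun, Fintype.card_fin, Fintype.card_coe, Int.card_Icc]
    refine Nat.pow_le_pow_left ?_ d
    omega
  · refine ⟨Function.invFun cell (cell x), Finset.mem_image_of_mem _ (Finset.mem_univ _), ?_⟩
    set y := Function.invFun cell (cell x)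
    have hy : cell y = cell x := Function.invFun_eq ⟨x, rfl⟩
    have hi (i : Fin d) : |(x : EuclideanSpace ℝ (Fin d)) i - (y : EuclideanSpace ℝ (Fin d)) i| ≤
        1 / m := by
      have h1 : ⌊(y : EuclideanSpace ℝ (Fin d)) i * m⌋ = ⌊(x : EuclideanSpace ℝ (Fin d)) i * m⌋ :=
        congrArg Subtype.val (congrFun hy i)
      have h2 := Int.abs_sub_lt_one_of_floor_eq_floor h1.symm
      rw [← sub_mul, abs_mul, abs_of_pos hm'] at h2
      rw [le_div_iff₀ hm']
      exact h2.le
    have hsum := (EuclideanSpace.basisFun (Fin d) ℝ).sum_repr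
      ((x : EuclideanSpace ℝ (Fin d)) - (y : EuclideanSpace ℝ (Fin d)))
    rw [← hsum]
    refine (norm_sum_le_of_le _ (f := fun i => _) (n := fun _ => 1 / (m : ℝ)) fun i _ => ?_).trans ?_
    · rw [norm_smul, (EuclideanSpace.basisFun (Fin d) ℝ).norm_eq_one, mul_one]
      exact hi i
    · simp [div_eq_mul_inv]

lemma abs_sub_abs_inner_le (w x y : USphere d) :
    |(|⟪(w : EuclideanSpace ℝ (Fin d)), (x : EuclideanSpace ℝ (Fin d))⟫| -
      |⟪(w : EuclideanSpace ℝ (Fin d)), (y : EuclideanSpace ℝ (Fin d))⟫|)| ≤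
      ‖(x : EuclideanSpace ℝ (Fin d)) - (y : EuclideanSpace ℝ (Fin d))‖ := by
  refine (abs_abs_sub_abs_le_abs_sub _ _).trans ?_
  rw [← inner_sub_right]
  have h := abs_real_inner_le_norm (w : EuclideanSpace ℝ (Fin d))
    ((x : EuclideanSpace ℝ (Fin d)) - (y : EuclideanSpace ℝ (Fin d)))
  rwa [norm_eq_of_mem_sphere, one_mul] at h

lemma measureReal_abs_sum_ge_le {X : Type*} [MeasurableSpace X] {μ : Measure X}
    [IsProbabilityMeasure μ] {Y : X → ℝ} (hY : Measurable Y) (hY1 : ∀ x, |Y x| ≤ 1) (n : ℕ)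
    {t : ℝ} (ht : 0 ≤ t) :
    (Measure.pi fun _ : Fin n => μ).real {ω | t ≤ |∑ i, (Y (ω i) - ∫ x, Y x ∂μ)|} ≤
      2 * Real.exp (-t ^ 2 / (2 * n)) := by
  set P := Measure.pi fun _ : Fin n => μ
  have key (Z : X → ℝ) (hZ : Measurable Z) (hZ1 : ∀ x, |Z x| ≤ 1) :
      P.real {ω | t ≤ ∑ i, (Z (ω i) - ∫ x, Z x ∂μ)} ≤ Real.exp (-t ^ 2 / (2 * n)) := by
    have hind : ProbabilityTheory.iIndepFun
        (fun (i : Fin n) (ω : Fin n → X) => Z (ω i) - ∫ x, Z x ∂μ) P :=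
      ProbabilityTheory.iIndepFun_pi (μ := fun _ : Fin n => μ)
        (X := fun _ x => Z x - ∫ x, Z x ∂μ) fun _ => (hZ.sub_const _).aemeasurable
    have hsub : ProbabilityTheory.HasSubgaussianMGF (fun x => Z x - ∫ x, Z x ∂μ)
        ((‖(1 : ℝ) - (-1)‖₊ / 2) ^ 2) μ :=
      ProbabilityTheory.hasSubgaussianMGF_of_mem_Icc hZ.aemeasurable
        (.of_forall fun x => abs_le.1 (hZ1 x))
    have hc : (‖(1 : ℝ) - (-1)‖₊ / 2) ^ 2 = 1 := by
      have : ‖(1 : ℝ) - (-1)‖₊ = 2 := by ext; norm_num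
      rw [this]; norm_num
    rw [hc] at hsub
    have hsub' (i : Fin n) : ProbabilityTheory.HasSubgaussianMGF
        (fun ω : Fin n → X => Z (ω i) - ∫ x, Z x ∂μ) 1 P := by
      refine ProbabilityTheory.HasSubgaussianMGF.of_map (Y := fun ω : Fin n → X => ω i)
        (X := fun x => Z x - ∫ x, Z x ∂μ) (measurable_pi_apply i).aemeasurable ?_
      rwa [(measurePreserving_eval (fun _ : Fin n => μ) i).map_eq]
    have h := ProbabilityTheory.HasSubgaussianMGF.measure_sum_ge_le_of_iIndepFun hind
      (c := fun _ => 1) (s := Finset.univ) (fun i _ => hsub' i) ht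
    simpa using h
  have h1 := key Y hY hY1
  have h2 := key (fun x => - Y x) hY.neg fun x => by rw [abs_neg]; exact hY1 x
  have hsubset : {ω : Fin n → X | t ≤ |∑ i, (Y (ω i) - ∫ x, Y x ∂μ)|} ⊆
      {ω | t ≤ ∑ i, (Y (ω i) - ∫ x, Y x ∂μ)} ∪
        {ω | t ≤ ∑ i, (- Y (ω i) - ∫ x, - Y x ∂μ)} := by
    intro ω hω
    rcases le_abs.1 (Set.mem_ofPred_eq ▸ hω) with h | h
    · exact Or.inl h
    · refine Or.inr ?_
      rw [Set.mem_ofPred_eq, integral_neg]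
      refine h.trans_eq ?_
      rw [← Finset.sum_neg_distrib]
      exact Finset.sum_congr rfl fun i _ => by ring
  have h3 := (measureReal_mono (μ := P) hsubset).trans (measureReal_union_le _ _)
  linarith

/-- If more than `2 d (4 m + 2) / δ ^ 2` points are sampled independently, then with positive
probability the sample means are uniformly close to the cosine transform. -/
lemma exists_sample_near_integral [NeZero d] {μ : Measure (USphere d)} [IsProbabilityMeasure μ]
    {σ : USphere d → ℝ} (hσ : Measurable σ) (hσ1 : ∀ w, |σ w| ≤ 1) {δ : ℝ} (hδ : 0 < δ) {m n : ℕ}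
    (hm : 0 < m) (hn : 2 * d * (4 * m + 2) / δ ^ 2 < n) :
    ∃ w : Fin n → USphere d, ∀ x : USphere d,
      |(∫ v : USphere d, σ v * |⟪(v : EuclideanSpace ℝ (Fin d)), (x : EuclideanSpace ℝ (Fin d))⟫| ∂μ) -
        absNetwork (fun i => σ (w i) / n) w x| ≤ δ + 2 * (d / m) := by
  set Y : USphere d → USphere d → ℝ := fun x v =>
    σ v * |⟪(v : EuclideanSpace ℝ (Fin d)), (x : EuclideanSpace ℝ (Fin d))⟫| with hYdef
  have hYm (x : USphere d) : Measurable (Y x) := by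
    refine hσ.mul (Continuous.measurable ?_)
    fun_prop
  have hY1 (x v : USphere d) : |Y x v| ≤ 1 := by
    simp only [hYdef, abs_mul, abs_abs]
    exact mul_le_one₀ (hσ1 v) (abs_nonneg _) (abs_inner_sphere_le_one v x)
  have hYint (x : USphere d) : Integrable (Y x) μ :=
    Integrable.of_bound (hYm x).aestronglyMeasurable 1 (.of_forall (hY1 x))
  have hYlip (x y v : USphere d) : |Y x v - Y y v| ≤
      ‖(x : EuclideanSpace ℝ (Fin d)) - (y : EuclideanSpace ℝ (Fin d))‖ := by
    simp only [hYdef, ← mul_sub, abs_mul]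
    exact (mul_le_of_le_one_left (abs_nonneg _) (hσ1 v)).trans (abs_sub_abs_inner_le v x y)
  have hn0 : (0 : ℝ) < n := lt_of_le_of_lt (by positivity) hn
  obtain ⟨T, hTcard, hT⟩ := exists_net_sphere (d := d) hm
  set P := Measure.pi fun _ : Fin n => μ
  set bad : USphere d → Set (Fin n → USphere d) := fun x =>
    {ω | n * δ ≤ |∑ i, (Y x (ω i) - ∫ v, Y x v ∂μ)|} with hbad
  have hlt : P.real (⋃ x ∈ T, bad x) < 1 := by
    have h1 : P.real (⋃ x ∈ T, bad x) ≤ ∑ x ∈ T, 2 * Real.exp (-(n * δ) ^ 2 / (2 * n)) :=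
      (measureReal_biUnion_finset_le T bad).trans
        (Finset.sum_le_sum fun x _ => measureReal_abs_sum_ge_le (hYm x) (hY1 x) n (by positivity))
    have h2 : (T.card : ℝ) * 2 ≤ Real.exp (d * (4 * m + 2)) := by
      have h3 : (T.card : ℝ) ≤ (2 * m + 1) ^ d := by exact_mod_cast hTcard
      have h4 : (2 : ℝ) ≤ 2 ^ d := le_self_pow₀ one_le_two (NeZero.ne d)
      calc (T.card : ℝ) * 2 ≤ (2 * m + 1) ^ d * 2 ^ d := by gcongr
        _ = (4 * m + 2) ^ d := by rw [← mul_pow]; ring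
        _ ≤ (Real.exp (4 * m + 2)) ^ d := by
          gcongr
          linarith [Real.add_one_le_exp (4 * m + 2 : ℝ)]
        _ = _ := (Real.exp_nat_mul _ _).symm
    refine h1.trans_lt ?_
    rw [Finset.sum_const, nsmul_eq_mul, ← mul_assoc]
    calc (T.card : ℝ) * 2 * Real.exp (-(n * δ) ^ 2 / (2 * n))
        ≤ Real.exp (d * (4 * m + 2)) * Real.exp (-(n * δ) ^ 2 / (2 * n)) := by gcongr
      _ = Real.exp (d * (4 * m + 2) - n * δ ^ 2 / 2) := by
        rw [← Real.exp_add]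
        congr 1
        field_simp
        ring
      _ < 1 := by
        rw [Real.exp_lt_one_iff, sub_neg, lt_div_iff₀ two_pos]
        rw [div_lt_iff₀ (by positivity)] at hn
        linarith
  have hex : ∃ ω : Fin n → USphere d, ω ∉ ⋃ x ∈ T, bad x := by
    by_contra! h
    rw [Set.eq_univ_of_forall h, probReal_univ] at hlt
    exact lt_irrefl _ hlt
  obtain ⟨w, hw⟩ := hex
  have hnet (x : USphere d) : absNetwork (fun i => σ (w i) / n) w x = (∑ i, Y x (w i)) / n := by
    rw [absNetwork, Finset.sum_div]
    exact Finset.sum_congr rfl fun i _ => by simp only [hYdef]; ring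
  refine ⟨w, fun x => ?_⟩
  obtain ⟨y, hyT, hxy⟩ := hT x
  rw [hnet x]
  have e1 : |(∫ v, Y x v ∂μ) - ∫ v, Y y v ∂μ| ≤ d / m := by
    rw [← integral_sub (hYint x) (hYint y)]
    have h := norm_integral_le_of_norm_le_const (μ := μ) (f := fun v => Y x v - Y y v)
      (C := (d / m : ℝ)) (.of_forall fun v => (hYlip x y v).trans hxy)
    rwa [probReal_univ, mul_one] at h
  have e2 : |(∑ i, Y x (w i)) / n - (∑ i, Y y (w i)) / n| ≤ d / m := by
    rw [← sub_div, ← Finset.sum_sub_distrib, abs_div, abs_of_pos hn0, div_le_iff₀ hn0]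
    refine (Finset.abs_sum_le_sum_abs _ _).trans
      ((Finset.sum_le_sum fun i _ => (hYlip x y (w i)).trans hxy).trans_eq ?_)
    simp [mul_comm]
  have e3 : |(∫ v, Y y v ∂μ) - (∑ i, Y y (w i)) / n| ≤ δ := by
    have h : w ∉ bad y := fun h => hw (Set.mem_biUnion hyT h)
    simp only [hbad, Set.mem_ofPred_eq, not_le, Finset.sum_sub_distrib, Finset.sum_const,
      Finset.card_univ, Fintype.card_fin, nsmul_eq_mul] at h
    have h5 : (∫ v, Y y v ∂μ) - (∑ i, Y y (w i)) / n =
        -((∑ i, Y y (w i)) - n * ∫ v, Y y v ∂μ) / n := by field_simp; ring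
    rw [h5, abs_div, abs_neg, abs_of_pos hn0, div_le_iff₀ hn0]
    linarith
  rw [abs_le] at *
  constructor <;> linarith [e1.1, e1.2, e2.1, e2.2, e3.1, e3.2]

/-- A cosine transform of a density with `L¹` norm at most `R` is approximated by a network of
polynomial size. -/
theorem exists_absNetwork_near [NeZero d] {g h : USphere d → ℝ} (hgm : Measurable g)
    (hg : Integrable g (uniformSphere d)) {R : ℝ} (hR : 1 ≤ R)
    (hgR : ∫ w, |g w| ∂(uniformSphere d) ≤ R)
    (hh : ∀ x : USphere d, h x = ∫ w : USphere d,
        |⟪(w : EuclideanSpace ℝ (Fin d)), (x : EuclideanSpace ℝ (Fin d))⟫| * g w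
          ∂(uniformSphere d)) {ε : ℝ} (hε : 0 < ε) (hε1 : ε < 1) :
    ∃ (n : ℕ) (u : Fin n → ℝ) (w : Fin n → USphere d),
      (∀ x, |h x - absNetwork u w x| ≤ ε) ∧
      (n : ℝ) + weightNorm u w ≤ 178 * (d ^ 2 * R ^ 3 * ε⁻¹ ^ 3) := by
  have hrep : ∃ (μ : Measure (USphere d)) (σ : USphere d → ℝ), IsProbabilityMeasure μ ∧
      Measurable σ ∧ (∀ w, |σ w| ≤ 1) ∧ ∀ x : USphere d, h x = R * ∫ v : USphere d,
        σ v * |⟪(v : EuclideanSpace ℝ (Fin d)), (x : EuclideanSpace ℝ (Fin d))⟫| ∂μ := by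
    set G := ∫ w, |g w| ∂(uniformSphere d) with hG
    have hG0 : 0 ≤ G := integral_nonneg fun w => abs_nonneg _
    rcases hG0.eq_or_lt with hG0 | hG0
    · refine ⟨uniformSphere d, 0, inferInstance, measurable_zero, by simp, fun x => ?_⟩
      have h0 : (fun w => |g w|) =ᵐ[uniformSphere d] 0 :=
        (integral_eq_zero_iff_of_nonneg (fun w => abs_nonneg _) hg.abs).1 hG0.symm
      rw [hh]
      simp only [Pi.zero_apply, zero_mul, integral_zero, mul_zero]
      refine integral_eq_zero_of_ae ?_
      filter_upwards [h0] with w hw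
      rw [abs_eq_zero.1 hw, mul_zero, Pi.zero_apply]
    · set ρ : USphere d → ℝ := fun w => |g w| / G with hρ
      have hρm : Measurable ρ := hgm.abs.div_const _
      refine ⟨(uniformSphere d).withDensity fun w => ENNReal.ofReal (ρ w),
        fun w => G / R * (g w / |g w|), ⟨?_⟩, ?_, fun w => ?_, fun x => ?_⟩
      · rw [withDensity_apply _ MeasurableSet.univ, Measure.restrict_univ,
          ← ofReal_integral_eq_lintegral_ofReal (hg.abs.div_const _)
            (.of_forall fun w => by positivity), integral_div, div_self hG0.ne', ENNReal.ofReal_one]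
      · exact (hgm.div hgm.abs).const_mul _
      · rw [abs_mul, abs_of_nonneg (by positivity : 0 ≤ G / R), abs_div, abs_abs]
        exact mul_le_one₀ ((div_le_one (by linarith)).2 hgR) (by positivity) (div_self_le_one _)
      · rw [hh, integral_withDensity_eq_integral_toReal_smul hρm.ennreal_ofReal
          (.of_forall fun w => ENNReal.ofReal_lt_top), ← integral_const_mul]
        refine integral_congr_ae (.of_forall fun w => ?_)
        simp only [smul_eq_mul, hρ]
        rw [ENNReal.toReal_ofReal (by positivity)]
        rcases eq_or_ne (g w) 0 with h0 | h0
        · simp [h0]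
        · have : |g w| ≠ 0 := abs_ne_zero.2 h0
          field_simp
  obtain ⟨μ, σ, hμ, hσ, hσ1, hrep⟩ := hrep
  have hd : (1 : ℝ) ≤ d := Nat.one_le_cast.2 (NeZero.one_le)
  have hR0 : 0 < R := by linarith
  set e := ε⁻¹ with he
  have he1 : 1 ≤ e := (one_le_inv₀ hε).2 hε1.le
  have he0 : e * ε = 1 := inv_mul_cancel₀ hε.ne'
  have hdRe : 1 ≤ d * R * e := one_le_mul_of_one_le_of_one_le
    (one_le_mul_of_one_le_of_one_le hd hR) he1
  set m := ⌈4 * (d * R * e)⌉₊ with hm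
  have hm1 : 4 * (d * R * e) ≤ m := Nat.le_ceil _
  have hm2 : (m : ℝ) < 4 * (d * R * e) + 1 := Nat.ceil_lt_add_one (by positivity)
  have hm0 : 0 < m := Nat.cast_pos.1 (lt_of_lt_of_le (by linarith) hm1)
  have hm0' : (0 : ℝ) < m := Nat.cast_pos.2 hm0
  set δ := ε / (2 * R) with hδ
  have hδ0 : 0 < δ := by positivity
  set n := ⌊176 * (d ^ 2 * R ^ 3 * e ^ 3)⌋₊ + 1 with hn
  have hn1 : 176 * (d ^ 2 * R ^ 3 * e ^ 3) < n := by
    rw [hn]; push_cast; exact Nat.lt_floor_add_one _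
  have hn2 : (n : ℝ) ≤ 176 * (d ^ 2 * R ^ 3 * e ^ 3) + 1 := by
    rw [hn]; push_cast; gcongr; exact Nat.floor_le (by positivity)
  have hlarge : 2 * d * (4 * m + 2) / δ ^ 2 < n := by
    refine lt_of_le_of_lt ?_ hn1
    have h1 : 2 * d * (4 * m + 2) / δ ^ 2 = 8 * d * R ^ 2 * e ^ 2 * (4 * m + 2) := by
      rw [hδ, he]; field_simp; ring
    rw [h1]
    calc 8 * d * R ^ 2 * e ^ 2 * (4 * m + 2) ≤ 8 * d * R ^ 2 * e ^ 2 * (22 * (d * R * e)) := by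
          gcongr; linarith
      _ = _ := by ring
  obtain ⟨w, hw⟩ := exists_sample_near_integral (μ := μ) hσ hσ1 hδ0 hm0 hlarge
  refine ⟨n, fun i => R * (σ (w i) / n), w, fun x => ?_, ?_⟩
  · have h1 : absNetwork (fun i => R * (σ (w i) / n)) w x =
        R * absNetwork (fun i => σ (w i) / n) w x := by
      rw [absNetwork, absNetwork, Finset.mul_sum]
      exact Finset.sum_congr rfl fun i _ => by ring
    rw [h1, hrep, ← mul_sub, abs_mul, abs_of_pos hR0]
    calc _ ≤ R * (δ + 2 * (d / m)) := by gcongr; exact hw x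
      _ ≤ R * (δ + 2 * (ε / (4 * R))) := by
        have h2 : (d : ℝ) / m ≤ ε / (4 * R) := by
          rw [div_le_div_iff₀ hm0' (by positivity)]
          calc (d : ℝ) * (4 * R) = ε * (4 * (d * R * e)) := by linear_combination (-4 * d * R) * he0
            _ ≤ ε * m := by gcongr
        gcongr R * (δ + 2 * ?_)
      _ = ε := by rw [hδ]; field_simp; ring
  · have hn0 : (1 : ℝ) ≤ n := Nat.one_le_cast.2 (Nat.le_add_left 1 _)
    have hW : weightNorm (fun i => R * (σ (w i) / n)) w ≤ R := by
      refine max_le ((pi_norm_le_iff_of_nonneg hR0.le).2 fun i => ?_)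
        ((pi_norm_le_iff_of_nonneg hR0.le).2 fun i =>
          (pi_norm_le_iff_of_nonneg hR0.le).2 fun j => ?_)
      · rw [Real.norm_eq_abs, abs_mul, abs_div, abs_of_pos hR0, Nat.abs_cast]
        exact mul_le_of_le_one_right hR0.le (div_le_one_of_le₀ ((hσ1 _).trans hn0) (by positivity))
      · have h := PiLp.norm_apply_le (w i : EuclideanSpace ℝ (Fin d)) j
        rw [norm_eq_of_mem_sphere] at h
        exact h.trans hR
    have h3 : 1 ≤ (d : ℝ) ^ 2 * R ^ 2 * e ^ 3 := one_le_mul_of_one_le_of_one_le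
      (one_le_mul_of_one_le_of_one_le (one_le_pow₀ hd) (one_le_pow₀ hR)) (one_le_pow₀ he1)
    have h4 : R ≤ d ^ 2 * R ^ 3 * e ^ 3 := by nlinarith
    linarith

end Sampling

/-! ### The concentration hypothesis -/

lemma componentL1_nonneg {d : ℕ} (k : ℕ) (f : C(USphere d, ℝ)) : 0 ≤ componentL1 k f :=
  integral_nonneg fun _ => abs_nonneg _

lemma componentL1_eq_zero_of_odd {d : ℕ} {f : C(USphere d, ℝ)} (hf : ∀ x, f (-x) = f x) {k : ℕ}
    (hk : Odd k) : componentL1 k f = 0 := by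
  rw [componentL1, sphComponent_eq_zero_of_odd hf hk]
  refine integral_eq_zero_of_ae ?_
  filter_upwards [Lp.coeFn_zero ℝ 2 (uniformSphere d)] with w hw
  rw [hw, Pi.zero_apply, abs_zero]

/-- Under the concentration hypotheses, `f^{(d)}` is the cosine transform of an even density with
`L¹` norm polynomial in `d`. -/
theorem exists_density_polynomial_bound
    (f : (d : ℕ) → C(USphere d, ℝ))
    (heven : ∀ d : ℕ, 2 ≤ d → ∀ x : USphere d, f d (-x) = f d x)
    {M N : ℝ} (hN : 0 < N) {C C' : ℝ}
    (hconc : ∀ d : ℕ, 2 ≤ d → ∀ k : ℕ,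
      √(sphDim d k : ℝ) * componentL1 k (f d) ≤
        C * ((max k 1 : ℕ) : ℝ) ^ M * (d : ℝ) ^ N * componentL2 k (f d))
    (hsum : ∀ d : ℕ, 2 ≤ d →
      Summable (fun k : ℕ => ((max k 1 : ℕ) : ℝ) ^ (M + 2) * componentL2 k (f d)) ∧
      ∑' k : ℕ, ((max k 1 : ℕ) : ℝ) ^ (M + 2) * componentL2 k (f d) ≤ C' * (d : ℝ) ^ N) :
    ∃ A B : ℝ, 1 ≤ A ∧ 0 < B ∧ ∀ d : ℕ, 2 ≤ d → ∃ g : USphere d → ℝ, Measurable g ∧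
      Integrable g (uniformSphere d) ∧ (∀ x, g (-x) = g x) ∧
      ∫ w, |g w| ∂(uniformSphere d) ≤ A * (d : ℝ) ^ B ∧
      ∀ x : USphere d, f d x = ∫ w : USphere d,
        |⟪(w : EuclideanSpace ℝ (Fin d)), (x : EuclideanSpace ℝ (Fin d))⟫| * g w
          ∂(uniformSphere d) := by
  obtain ⟨c, hc, hmult⟩ := exists_le_sqrt_sphDim_mul_absMult
  refine ⟨max 1 (c⁻¹ * |C| * |C'|), 2 * N + 1, le_max_left _ _, by positivity, fun d hd => ?_⟩
  have : NeZero d := ⟨by omega⟩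
  have hd0 : (0 : ℝ) < d := Nat.cast_pos.2 (by omega)
  have hk0 (k : ℕ) : (0 : ℝ) < ((max k 1 : ℕ) : ℝ) := Nat.cast_pos.2 (by omega)
  have hne (k : ℕ) (hk : Even k) : absMult d k ≠ 0 := fun h => by
    have := hmult d hd k hk
    rw [h, abs_zero, mul_zero, zero_mul] at this
    linarith
  have hterm (k : ℕ) : |absMult d k|⁻¹ * componentL1 k (f d) ≤
      c⁻¹ * |C| * (d : ℝ) ^ (N + 1) *
        (((max k 1 : ℕ) : ℝ) ^ (M + 2) * componentL2 k (f d)) := by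
    rcases Nat.even_or_odd k with hk | hk
    · have ha : 0 < |absMult d k| := abs_pos.2 (hne k hk)
      have h1 : |absMult d k|⁻¹ ≤
          c⁻¹ * (√(sphDim d k : ℝ) * ((d : ℝ) * ((max k 1 : ℕ) : ℝ) ^ 2)) := by
        rw [inv_le_iff_one_le_mul₀ ha, inv_mul_eq_div, div_mul_eq_mul_div, one_le_div hc]
        exact (hmult d hd k hk).trans_eq (by ring)
      have h2 : √(sphDim d k : ℝ) * componentL1 k (f d) ≤
          |C| * ((max k 1 : ℕ) : ℝ) ^ M * (d : ℝ) ^ N * componentL2 k (f d) := by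
        refine (hconc d hd k).trans ?_
        have h0 : 0 ≤ componentL2 k (f d) := norm_nonneg _
        gcongr
        exact le_abs_self C
      calc |absMult d k|⁻¹ * componentL1 k (f d)
          ≤ c⁻¹ * (√(sphDim d k : ℝ) * ((d : ℝ) * ((max k 1 : ℕ) : ℝ) ^ 2)) *
            componentL1 k (f d) := by
              gcongr
              exact componentL1_nonneg k (f d)
        _ = c⁻¹ * ((d : ℝ) * ((max k 1 : ℕ) : ℝ) ^ 2) *
            (√(sphDim d k : ℝ) * componentL1 k (f d)) := by ring
        _ ≤ c⁻¹ * ((d : ℝ) * ((max k 1 : ℕ) : ℝ) ^ 2) *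
            (|C| * ((max k 1 : ℕ) : ℝ) ^ M * (d : ℝ) ^ N * componentL2 k (f d)) := by gcongr
        _ = _ := by
          rw [Real.rpow_add_one hd0.ne', Real.rpow_add (hk0 k), Real.rpow_two]
          ring
    · rw [componentL1_eq_zero_of_odd (heven d hd) hk, mul_zero]
      have h0 : 0 ≤ componentL2 k (f d) := norm_nonneg _
      positivity
  have hmaj := (hsum d hd).1.mul_left (c⁻¹ * |C| * (d : ℝ) ^ (N + 1))
  have hS : Summable fun k => |absMult d k|⁻¹ * componentL1 k (f d) :=
    Summable.of_nonneg_of_le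
      (fun k => mul_nonneg (by positivity) (componentL1_nonneg k (f d))) hterm hmaj
  obtain ⟨g, hgm, hg, hge, hgn, hgf⟩ := exists_density_of_summable (heven d hd) hne hS
  refine ⟨g, hgm, hg, hge, hgn.trans ?_, hgf⟩
  calc ∑' k, |absMult d k|⁻¹ * componentL1 k (f d)
      ≤ c⁻¹ * |C| * (d : ℝ) ^ (N + 1) *
        ∑' k : ℕ, ((max k 1 : ℕ) : ℝ) ^ (M + 2) * componentL2 k (f d) := by
          rw [← tsum_mul_left]
          exact hS.tsum_le_tsum hterm hmaj
    _ ≤ c⁻¹ * |C| * (d : ℝ) ^ (N + 1) * (|C'| * (d : ℝ) ^ N) := by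
      gcongr
      refine (hsum d hd).2.trans ?_
      gcongr
      exact le_abs_self C'
    _ = c⁻¹ * |C| * |C'| * (d : ℝ) ^ (2 * N + 1) := by
      rw [show 2 * N + 1 = (N + 1) + N by ring, Real.rpow_add hd0 (N + 1) N]
      ring
    _ ≤ _ := by
      gcongr
      exact le_max_right _ _

end

theorem mainTheorem7
    (f : (d : ℕ) → C(USphere d, ℝ))
    (heven : ∀ d : ℕ, 2 ≤ d → ∀ x : USphere d, f d (-x) = f d x)
    (M N : ℝ) (hM : 0 < M) (hN : 0 < N)
    (hconc : ∃ C : ℝ, ∀ d : ℕ, 2 ≤ d → ∀ k : ℕ,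
      √(sphDim d k : ℝ) * componentL1 k (f d) ≤
        C * ((max k 1 : ℕ) : ℝ) ^ M * (d : ℝ) ^ N * componentL2 k (f d))
    (hsum : ∃ C : ℝ, ∀ d : ℕ, 2 ≤ d →
      Summable (fun k : ℕ => ((max k 1 : ℕ) : ℝ) ^ (M + 2) * componentL2 k (f d)) ∧
      ∑' k : ℕ, ((max k 1 : ℕ) : ℝ) ^ (M + 2) * componentL2 k (f d) ≤ C * (d : ℝ) ^ N) :
    (∃ A B : ℝ, ∀ d : ℕ, 2 ≤ d → gammaOne (f d) ≤ ENNReal.ofReal (A * (d : ℝ) ^ B)) ∧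
      UniversallyApproximableAbs (fun d => f d) := by
  obtain ⟨C, hconc⟩ := hconc
  obtain ⟨C', hsum⟩ := hsum
  obtain ⟨A, B, hA, hB, hdens⟩ := exists_density_polynomial_bound f heven hN hconc hsum
  refine ⟨⟨A, B, fun d hd => ?_⟩, 178 * A ^ 3, by positivity, 5 + 3 * B, by positivity,
    fun d hd ε hε hε1 => ?_⟩
  · obtain ⟨g, hgm, hg, hge, hgn, hgf⟩ := hdens d hd
    exact (gammaOne_le_of_density hgm hg hge hgf).trans (ENNReal.ofReal_le_ofReal hgn)
  · obtain ⟨g, hgm, hg, hge, hgn, hgf⟩ := hdens d hd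
    have : NeZero d := ⟨by omega⟩
    have hd1 : (1 : ℝ) ≤ d := Nat.one_le_cast.2 (by omega)
    have he1 : 1 ≤ ε⁻¹ := (one_le_inv₀ hε).2 hε1.le
    have hR : 1 ≤ A * (d : ℝ) ^ B :=
      one_le_mul_of_one_le_of_one_le hA (Real.one_le_rpow hd1 hB.le)
    obtain ⟨n, u, w, happ, hsize⟩ := exists_absNetwork_near hgm hg hR hgn hgf hε hε1
    refine ⟨n, u, w, happ, hsize.trans ?_⟩
    have h1 : (d : ℝ) ^ 2 * (A * (d : ℝ) ^ B) ^ 3 = A ^ 3 * (d : ℝ) ^ (2 + 3 * B) := by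
      rw [Real.rpow_add (by linarith), Real.rpow_two, mul_comm 3 B, Real.rpow_mul (by linarith)]
      norm_cast
      ring
    have h2 : (d : ℝ) ^ (2 + 3 * B) ≤ (d : ℝ) ^ (5 + 3 * B) :=
      Real.rpow_le_rpow_of_exponent_le hd1 (by linarith)
    have h3 : ε⁻¹ ^ 3 ≤ ε⁻¹ ^ (5 + 3 * B) := by
      rw [← Real.rpow_natCast]
      exact Real.rpow_le_rpow_of_exponent_le he1 (by push_cast; linarith)
    rw [h1, Real.mul_rpow (by positivity) (by positivity)]
    calc 178 * (A ^ 3 * (d : ℝ) ^ (2 + 3 * B) * ε⁻¹ ^ 3)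
        ≤ 178 * (A ^ 3 * (d : ℝ) ^ (5 + 3 * B) * ε⁻¹ ^ (5 + 3 * B)) := by gcongr
      _ = _ := by ring
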